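/- All graphs are finite and simple, and are considered up to isomorphism. A graph is $k$-critical if its chromatic number is $k$ and none of its proper induced subgraphs has chromatic number $k$. Let $P_5$ be the path on five vertices and $\overline{P}_5$ its complement, and let $\mathcal{C}_k$ be the set of $k$-critical graphs that contain neither $P_5$ nor $\overline{P}_5$ as an induced subgraph. Write $K_n$ for the clique on $n$ vertices and $C_5$ for the cycle on five vertices. The join of two graphs is their disjoint union together with all edges between them, and $\mathcal{A}\otimes\mathcal{B}$ is the set of joins of a member of $\mathcal{A}$ and a member of $\mathcal{B}$. The buoy $(B_1,\dots,B_5)$ is the graph obtained from $C_5$ by substituting the graph $B_i$ for its $i$-th vertex: vertices of cyclically consecutive bags are all adjacent, vertices of non-consecutive distinct bags are non-adjacent, and each bag induces $B_i$. An admissible pattern for $k$ is a vector $(k_1,\dots,k_5)$ of positive integers with $k_i+k_{i+1}\le k-1$ for each $i$ modulo $5$ and $\sum_{i=1}^5 k_i=2k-1$. A pattern $(k_1,\dots,k_5)$ yields the buoys $(B_1,\dots,B_5)$ with $B_i\in\mathcal{C}_{k_i}$ for each $i$. Let $\mathcal{B}_k$ be the set of buoys yielded by the admissible patterns for $k$,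 and let $\mathcal{J}_k=\bigcup_{k_1+k_2=k,\ k_1,k_2\ge 1}\mathcal{C}_{k_1}\otimes\mathcal{C}_{k_2}$. Patterns are listed up to rotation and reflection, each once. Then the following hold. 1. $\mathcal{C}_1=\{K_1\}$, $\mathcal{C}_2=\{K_2\}$, $\mathcal{C}_3=\{K_3,C_5\}$ with $|\mathcal{C}_3|=2$; $\mathcal{B}_1=\mathcal{B}_2=\emptyset$ and $\mathcal{B}_3=\{C_5\}$. 2. $\mathcal{C}_4=\mathcal{J}_4\cup\mathcal{B}_4$. The only admissible pattern for $4$ is $(1,2,1,2,1)$, and $\mathcal{B}_4=\{T_3\}$. Moreover $\mathcal{J}_4=\mathcal{C}_1\otimes\mathcal{C}_3=\{T_1,T_2\}$. Hence $\mathcal{C}_4=\{T_1,T_2,T_3\}$ and $|\mathcal{C}_4|=3$. Here $T_1=K_4$; $T_2$ is the wheel consisting of a $5$-cycle and a vertex adjacent to all of it; and $T_3$ consists of a $5$-cycle $v_1v_2v_3v_4v_5$, a vertex adjacent to exactly $v_1,v_2,v_5$ and a vertex adjacent to exactly $v_2,v_3,v_4$. 3. $\mathcal{C}_5=\mathcal{J}_5\cup\mathcal{B}_5$.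 The admissible patterns for $5$ are $(2,2,2,2,1)$, $(2,1,3,1,2)$ and $(1,3,1,3,1)$. They yield, respectively, exactly the buoys $F_4=(K_2,K_2,K_2,K_2,K_1)$; $F_5=(K_2,K_1,K_3,K_1,K_2)$ and $F_6=(K_2,K_1,C_5,K_1,K_2)$; and $F_7=(K_1,K_3,K_1,K_3,K_1)$, $F_8=(K_1,K_3,K_1,C_5,K_1)$ and $F_9=(K_1,C_5,K_1,C_5,K_1)$; and $|\mathcal{B}_5|=6$. Moreover $\mathcal{J}_5=\mathcal{C}_1\otimes\mathcal{C}_4=\{F_1,F_2,F_3\}$, where $F_i$ is the join of $K_1$ and $T_i$. Hence $\mathcal{C}_5=\{F_1,\dots,F_9\}$ and $|\mathcal{C}_5|=9$. 4. $\mathcal{C}_6=\mathcal{J}_6\cup\mathcal{B}_6$. The admissible patterns for $6$ are $(2,2,2,2,3)$, $(2,3,2,3,1)$, $(2,3,1,3,2)$, $(1,4,1,3,2)$ and $(1,4,1,4,1)$; they yield $2$, $4$, $3$, $6$ and $6$ graphs respectively, $\mathcal{B}_6$ is the union of these five sets of graphs, and $|\mathcal{B}_6|=21$. Moreover $\mathcal{J}_6=(\mathcal{C}_1\otimes\mathcal{C}_5)\cup(\mathcal{B}_3\otimes\mathcal{B}_3)$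 and $|\mathcal{J}_6|=10$. Hence $|\mathcal{C}_6|=31$. -/

import Mathlib

open scoped SimpleGraph

/-- A finite simple graph. -/
structure FinGraph where
  /-- the vertex type -/
  V : Type
  finite : Finite V
  /-- the adjacency structure -/
  graph : SimpleGraph V

namespace FinGraph

/-- Isomorphism of finite graphs. -/
instance isoSetoid : Setoid FinGraph where
  r G H := Nonempty (G.graph ≃g H.graph)
  iseqv :=
    { refl := fun _ => ⟨SimpleGraph.Iso.refl⟩
      symm := fun ⟨e⟩ => ⟨e.symm⟩
      trans := fun ⟨e⟩ ⟨f⟩ => ⟨e.trans f⟩ }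

/-- Isomorphism classes of finite graphs. Sets of graphs are sets of such classes, so
that cardinalities count graphs up to isomorphism. -/
abbrev IsoClass : Type 1 := Quotient isoSetoid

/-- The isomorphism class of a finite graph. -/
def cls (G : FinGraph) : IsoClass := Quotient.mk isoSetoid G

/-- `G` is `k`-critical: `χ(G) = k`, and no proper induced subgraph has chromatic number `k`. -/
def IsCritical (G : FinGraph) (k : ℕ) : Prop :=
  G.graph.chromaticNumber = k ∧
    ∀ S : Set G.V, S ≠ Set.univ → (G.graph.induce S).chromaticNumber ≠ k

/-- `G` has no induced subgraph isomorphic to the path `P₅` on five vertices or to its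
complement. -/
def IsP5CoP5Free (G : FinGraph) : Prop :=
  ¬ SimpleGraph.pathGraph 5 ⊴ G.graph ∧ ¬ (SimpleGraph.pathGraph 5)ᶜ ⊴ G.graph

/-- The family `𝒞 k` of `k`-critical graphs without induced `P₅` or complement of `P₅`. -/
def critFamily (k : ℕ) : Set IsoClass :=
  cls '' {G | G.IsCritical k ∧ G.IsP5CoP5Free}

/-- The clique on `n` vertices. -/
def K (n : ℕ) : FinGraph := ⟨Fin n, inferInstance, ⊤⟩

/-- The cycle on five vertices. -/
def C5 : FinGraph := ⟨Fin 5, inferInstance, SimpleGraph.cycleGraph 5⟩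

/-- The join of two graphs: the disjoint union with all edges between the two sides added. -/
def join (G H : FinGraph) : FinGraph where
  V := G.V ⊕ H.V
  finite := by
    have := G.finite
    have := H.finite
    infer_instance
  graph := (G.graph ⊕g H.graph) ⊔ completeBipartiteGraph G.V H.V

/-- The buoy with bags `B 0, …, B 4`: the graph obtained from the cycle `C₅` by substituting
`B i` for the vertex `i`. Two vertices of the same bag are adjacent when they are so in that
bag; vertices of distinct bags `i`, `j` are adjacent when `i`, `j` are consecutive on `C₅`. -/
def buoy (B : Fin 5 → FinGraph) : FinGraph where
  V := Σ i, (B i).V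
  finite := by
    have := fun i => (B i).finite
    infer_instance
  graph :=
    { Adj := fun a b =>
        (SimpleGraph.cycleGraph 5).Adj a.1 b.1 ∨
          ∃ (i : Fin 5) (x y : (B i).V), a = ⟨i, x⟩ ∧ b = ⟨i, y⟩ ∧ (B i).graph.Adj x y
      symm := ⟨by
        rintro a b (h | ⟨i, x, y, ha, hb, h⟩)
        · exact Or.inl h.symm
        · exact Or.inr ⟨i, y, x, hb, ha, h.symm⟩⟩
      loopless := ⟨by
        rintro a (h | ⟨i, x, y, ha, hb, h⟩)
        · exact (SimpleGraph.cycleGraph 5).loopless.irrefl _ h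
        · rw [ha] at hb
          obtain rfl : x = y := by simpa using hb
          exact (B i).graph.loopless.irrefl x h⟩ }

/-- `𝒜 ⊗ ℬ`: the set of all joins of a member of `𝒜` and a member of `ℬ`. -/
def joinSet (A B : Set IsoClass) : Set IsoClass :=
  {c | ∃ G H : FinGraph, G.cls ∈ A ∧ H.cls ∈ B ∧ c = (join G H).cls}

/-- The vector `p` of positive integers is an admissible pattern for `k`: cyclically consecutive
entries satisfy `p i + p (i + 1) ≤ k - 1` (addition in `Fin 5` is modulo 5), and the sum of all
entries is `2 k - 1`. -/
def IsPattern (k : ℕ) (p : Fin 5 → ℕ) : Prop :=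
  (∀ i, 0 < p i) ∧ (∀ i, p i + p (i + 1) + 1 ≤ k) ∧ ∑ i, p i + 1 = 2 * k

/-- The buoys with pattern `p`: the `i`-th bag is a member of `𝒞 (p i)`. -/
def buoysOfPattern (p : Fin 5 → ℕ) : Set IsoClass :=
  {c | ∃ B : Fin 5 → FinGraph, (∀ i, (B i).cls ∈ critFamily (p i)) ∧ c = (buoy B).cls}

/-- `𝒥 k`: the joins of a member of `𝒞 k₁` and a member of `𝒞 k₂`, for positive integers
`k₁`, `k₂` with `k₁ + k₂ = k`. -/
def joinFamily (k : ℕ) : Set IsoClass :=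
  {c | ∃ k₁ k₂ : ℕ, 0 < k₁ ∧ 0 < k₂ ∧ k₁ + k₂ = k ∧
    c ∈ joinSet (critFamily k₁) (critFamily k₂)}

/-- `ℬ k`: the buoys whose pattern is admissible for `k`. -/
def buoyFamily (k : ℕ) : Set IsoClass :=
  {c | ∃ p, IsPattern k p ∧ c ∈ buoysOfPattern p}

/-- Two vectors agree up to a rotation or a reflection of the cyclic order of the indices. -/
def CircEquiv (p q : Fin 5 → ℕ) : Prop :=
  ∃ c : Fin 5, (∀ i, p i = q (c + i)) ∨ (∀ i, p i = q (c - i))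

/-- Up to rotation and reflection, the admissible patterns for `k` are exactly the members of
the list `L`, each of them once. -/
def PatternsAre (k : ℕ) (L : List (Fin 5 → ℕ)) : Prop :=
  (∀ p, IsPattern k p ↔ ∃ q ∈ L, CircEquiv p q) ∧ L.Pairwise fun p q => ¬ CircEquiv p q

/-- The 4-critical graph `T₁`, the clique on four vertices. -/
def T1 : FinGraph := K 4

/-- The 4-critical graph `T₂`, the wheel with five spokes: a cycle `0 1 2 3 4` and a vertex `5`
adjacent to all of it. -/
def T2 : FinGraph where
  V := Fin 6
  finite := inferInstance
  graph := SimpleGraph.fromEdgeSet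
    {s(0, 1), s(1, 2), s(2, 3), s(3, 4), s(4, 0),
      s(5, 0), s(5, 1), s(5, 2), s(5, 3), s(5, 4)}

/-- The 4-critical graph `T₃`: a cycle `0 1 2 3 4`, a vertex `5` adjacent to `0, 1, 4`, and a
vertex `6` adjacent to `1, 2, 3`. -/
def T3 : FinGraph where
  V := Fin 7
  finite := inferInstance
  graph := SimpleGraph.fromEdgeSet
    {s(0, 1), s(1, 2), s(2, 3), s(3, 4), s(4, 0),
      s(5, 0), s(5, 1), s(5, 4), s(6, 1), s(6, 2), s(6, 3)}

/-- The join of a single vertex with `T₁`. -/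
def F1 : FinGraph := join (K 1) T1

/-- The join of a single vertex with `T₂`. -/
def F2 : FinGraph := join (K 1) T2

/-- The join of a single vertex with `T₃`. -/
def F3 : FinGraph := join (K 1) T3

/-- The buoy with bags `K₂, K₂, K₂, K₂, K₁`. -/
def F4 : FinGraph := buoy ![K 2, K 2, K 2, K 2, K 1]

/-- The buoy with bags `K₂, K₁, K₃, K₁, K₂`. -/
def F5 : FinGraph := buoy ![K 2, K 1, K 3, K 1, K 2]

/-- The buoy with bags `K₂, K₁, C₅, K₁, K₂`. -/
def F6 : FinGraph := buoy ![K 2, K 1, C5, K 1, K 2]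

/-- The buoy with bags `K₁, K₃, K₁, K₃, K₁`. -/
def F7 : FinGraph := buoy ![K 1, K 3, K 1, K 3, K 1]

/-- The buoy with bags `K₁, K₃, K₁, C₅, K₁`. -/
def F8 : FinGraph := buoy ![K 1, K 3, K 1, C5, K 1]

/-- The buoy with bags `K₁, C₅, K₁, C₅, K₁`. -/
def F9 : FinGraph := buoy ![K 1, C5, K 1, C5, K 1]

end FinGraph

/-!
Substitution reduces everything to small quotients. If `G` is obtained by substituting graphs for
the vertices of `Q`, then `G` is critical if and only if its bags are critical and their chromatic
numbers form a critical weight on `Q`, where a weight on `Q` is coloured by giving each vertex a set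
of colours of that size.

In a `P₅`- and house-free graph, an induced buoy of maximal size is homogeneous. Contracting such
buoys, one finds that the graph is either itself a buoy or a substitution into a graph without an
induced `C₅`. In the latter graph, and in all its blow-ups by cliques, ordering the vertices by
decreasing degree is a perfect order in the sense of Chvátal, so the greedy colouring of the order
uses as many colours as some clique has vertices. A critical weight therefore lives on a complete
graph and `G` is a join. On `C₅`, a weight can be coloured as soon as it satisfies the two obvious
counting bounds, those of an edge and of the whole cycle, which makes the critical weights exactly
the admissible patterns. Hence `𝒞ₖ` is the union of `𝒥ₖ` and `ℬₖ`.

For small `k` the degree multisets distinguish all the graphs produced in this way, except for the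
buoys that a reflection of the pattern identifies.
-/

namespace FinGraph

open SimpleGraph

/-! ### Critical sets and multicolourings -/

section Coloring

variable {V : Type*} {G : SimpleGraph V} {S T : Set V} {k n : ℕ}

lemma colorable_induce_mono (hST : S ⊆ T) (h : (G.induce T).Colorable n) :
    (G.induce S).Colorable n :=
  h.of_hom (G.induceHomOfLE hST).toHom

lemma colorable_induce_of_diff_singleton {v : V} (h : (G.induce (S \ {v})).Colorable n) :
    (G.induce S).Colorable (n + 1) := by
  classical
  obtain ⟨c⟩ := h
  let c' : (G.induce S).Coloring (Option (Fin n)) := Coloring.mk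
    (fun u => if hu : (u : V) = v then none else some (c ⟨u, u.2, hu⟩)) (by
      rintro ⟨u, hu⟩ ⟨w, hw⟩ (huw : G.Adj u w)
      by_cases hu' : u = v <;> by_cases hw' : w = v
      · exact absurd (hu'.trans hw'.symm) huw.ne
      · simp [hu', hw']
      · simp [hu', hw']
      · simpa [hu', hw'] using c.valid (v := ⟨u, hu, hu'⟩) (w := ⟨w, hw, hw'⟩) huw)
  simpa using c'.colorable

/-- The subgraph of `G` induced by `S` has chromatic number `k`, and the deletion of any vertex
lowers it. Chromatic numbers are expressed through colourability, so that infinite graphs and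
`ℕ∞` play no role. -/
structure IsCriticalOn (G : SimpleGraph V) (S : Set V) (k : ℕ) : Prop where
  le_of_colorable : ∀ {n}, (G.induce S).Colorable n → k ≤ n
  exists_colorable_diff : ∀ {v}, v ∈ S → ∃ n, n + 1 = k ∧ (G.induce (S \ {v})).Colorable n

namespace IsCriticalOn

lemma pos (h : IsCriticalOn G S k) (hS : S.Nonempty) : 0 < k := by
  obtain ⟨v, hv⟩ := hS
  obtain ⟨n, rfl, -⟩ := h.exists_colorable_diff hv
  exact n.succ_pos

lemma nonempty (h : IsCriticalOn G S k) (hk : 0 < k) : S.Nonempty := by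
  by_contra hS
  rw [Set.not_nonempty_iff_eq_empty] at hS
  subst hS
  exact hk.not_ge (h.le_of_colorable (.of_isEmpty 0))

lemma colorable_iff (h : IsCriticalOn G S k) : (G.induce S).Colorable n ↔ k ≤ n := by
  refine ⟨h.le_of_colorable, fun hkn => ?_⟩
  rcases S.eq_empty_or_nonempty with rfl | ⟨v, hv⟩
  · exact .of_isEmpty n
  · obtain ⟨l, rfl, hl⟩ := h.exists_colorable_diff hv
    exact (colorable_induce_of_diff_singleton hl).mono hkn

lemma colorable_diff_iff (h : IsCriticalOn G S k) {v : V} (hv : v ∈ S) :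
    (G.induce (S \ {v})).Colorable n ↔ k - 1 ≤ n := by
  constructor
  · intro hn
    have := h.le_of_colorable (colorable_induce_of_diff_singleton hn)
    omega
  · intro hkn
    obtain ⟨l, rfl, hl⟩ := h.exists_colorable_diff hv
    exact hl.mono hkn

end IsCriticalOn

end Coloring

section Multicoloring

variable {ι κ : Type*} {Q : SimpleGraph ι} {R : SimpleGraph κ} {k l : ι → ℕ} {m n : ℕ}

/-- Every vertex `i` of `Q` can be given a set of at least `k i` colours out of `n` in such a way
that adjacent vertices have disjoint sets. -/
def IsMulticolorable (Q : SimpleGraph ι) (k : ι → ℕ) (n : ℕ) : Prop :=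
  ∃ A : ι → Finset (Fin n), (∀ i, k i ≤ (A i).card) ∧ ∀ i j, Q.Adj i j → Disjoint (A i) (A j)

/-- The weighted analogue of criticality: `m` is the least number of colours in a multicolouring
of `Q` with demands `k`, and lowering any one demand makes `m - 1` colours sufficient. -/
structure IsCriticalWeight [DecidableEq ι] (Q : SimpleGraph ι) (k : ι → ℕ) (m : ℕ) : Prop where
  le_of_isMulticolorable : ∀ {n}, IsMulticolorable Q k n → m ≤ n
  exists_isMulticolorable_update : ∀ i, ∃ n, n + 1 = m ∧
    IsMulticolorable Q (Function.update k i (k i - 1)) n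

lemma isMulticolorable_of_finset_nat (A : ι → Finset ℕ) (hA : ∀ i, ∀ c ∈ A i, c < n)
    (hk : ∀ i, k i ≤ (A i).card) (hd : ∀ i j, Q.Adj i j → Disjoint (A i) (A j)) :
    IsMulticolorable Q k n := by
  refine ⟨fun i => (A i).attachFin (hA i), by simpa using hk, fun i j hij => ?_⟩
  rw [Finset.disjoint_left]
  intro c hi hj
  exact Finset.disjoint_left.1 (hd i j hij) ((Finset.mem_attachFin _).1 hi)
    ((Finset.mem_attachFin _).1 hj)

lemma IsMulticolorable.anti (h : IsMulticolorable Q l n) (hkl : ∀ i, k i ≤ l i) :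
    IsMulticolorable Q k n := by
  obtain ⟨A, hA, hd⟩ := h
  exact ⟨A, fun i => (hkl i).trans (hA i), hd⟩

lemma IsMulticolorable.comap (h : IsMulticolorable Q k n) (f : R →g Q) :
    IsMulticolorable R (k ∘ f) n := by
  obtain ⟨A, hA, hd⟩ := h
  exact ⟨A ∘ f, fun i => hA (f i), fun i j hij => hd _ _ (f.map_adj hij)⟩

/-- Double counting: every colour is used on a stable set only. -/
lemma IsMulticolorable.sum_le_mul (h : IsMulticolorable Q k n) {C : Finset ι} {a : ℕ}
    (hC : ∀ s ⊆ C, Q.IsIndepSet s → s.card ≤ a) : ∑ i ∈ C, k i ≤ n * a := by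
  classical
  obtain ⟨A, hA, hd⟩ := h
  calc ∑ i ∈ C, k i ≤ ∑ i ∈ C, (A i).card := Finset.sum_le_sum fun i _ => hA i
    _ = ∑ c : Fin n, (C.filter fun i => c ∈ A i).card := by
      simpa [Finset.bipartiteAbove, Finset.bipartiteBelow] using
        Finset.sum_card_bipartiteAbove_eq_sum_card_bipartiteBelow
          (s := C) (t := (Finset.univ : Finset (Fin n))) fun i c => c ∈ A i
    _ ≤ ∑ _c : Fin n, a := Finset.sum_le_sum fun c _ => hC _ (Finset.filter_subset _ _) (by
        intro i hi j hj _ hij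
        exact Finset.disjoint_left.1 (hd i j hij) (Finset.mem_filter.1 hi).2
          (Finset.mem_filter.1 hj).2)
    _ = n * a := by simp

lemma IsMulticolorable.sum_le_of_isClique (h : IsMulticolorable Q k n) {C : Finset ι}
    (hC : Q.IsClique C) : ∑ i ∈ C, k i ≤ n := by
  simpa using h.sum_le_mul (C := C) (a := 1) fun s hs hind => Finset.card_le_one.2
    fun i hi j hj => by
      by_contra hij
      exact hind hi hj hij (hC (hs hi) (hs hj) hij)

lemma sum_update_pred_add_one [Fintype ι] [DecidableEq ι] {i : ι} (hi : 0 < k i) :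
    ∑ j, Function.update k i (k i - 1) j + 1 = ∑ j, k j := by
  rw [Finset.sum_update_of_mem (Finset.mem_univ i), ← Finset.add_sum_erase _ k (Finset.mem_univ i),
    Finset.sdiff_singleton_eq_erase]
  omega

theorem isMulticolorable_top_iff [Fintype ι] :
    IsMulticolorable (⊤ : SimpleGraph ι) k n ↔ ∑ i, k i ≤ n := by
  refine ⟨fun h => h.sum_le_of_isClique fun i _ j _ hij => hij, fun h => ?_⟩
  obtain ⟨e⟩ : Nonempty ((Σ i, Fin (k i)) ↪ Fin n) :=
    Function.Embedding.nonempty_of_card_le (by simpa using h)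
  refine ⟨fun i => Finset.univ.map ((Function.Embedding.sigmaMk i).trans e), by simp,
    fun i j hij => ?_⟩
  rw [Finset.disjoint_left]
  simp only [Finset.mem_map, Finset.mem_univ, true_and]
  rintro _ ⟨x, rfl⟩ ⟨y, hy⟩
  exact hij (congrArg Sigma.fst (e.injective hy)).symm

theorem isCriticalWeight_top_iff [Fintype ι] [DecidableEq ι] [Nonempty ι] (hk : ∀ i, 0 < k i) :
    IsCriticalWeight (⊤ : SimpleGraph ι) k m ↔ ∑ i, k i = m := by
  constructor
  · intro h
    obtain ⟨i⟩ := ‹Nonempty ι›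
    obtain ⟨n, rfl, hn⟩ := h.exists_isMulticolorable_update i
    have := isMulticolorable_top_iff.1 hn
    have := h.le_of_isMulticolorable (isMulticolorable_top_iff.2 le_rfl)
    have := sum_update_pred_add_one (hk i)
    omega
  · rintro rfl
    exact ⟨isMulticolorable_top_iff.1,
      fun i => ⟨_, sum_update_pred_add_one (hk i), isMulticolorable_top_iff.2 le_rfl⟩⟩

end Multicoloring

section FiveCycle

variable {k : Fin 5 → ℕ} {m n : ℕ}

lemma cycleGraph_five_adj {i j : Fin 5} :
    (cycleGraph 5).Adj i j ↔ j = i + 1 ∨ i = j + 1 := by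
  revert i j
  decide

lemma isMulticolorable_cycleGraph_five_of_disjoint {A : Fin 5 → Finset ℕ}
    (hA : ∀ i, ∀ c ∈ A i, c < n) (hk : ∀ i, k i ≤ (A i).card)
    (hd : ∀ i, Disjoint (A i) (A (i + 1))) : IsMulticolorable (cycleGraph 5) k n := by
  refine isMulticolorable_of_finset_nat A hA hk fun i j hij => ?_
  rcases cycleGraph_five_adj.1 hij with rfl | rfl
  · exact hd i
  · exact (hd j).symm

lemma isMulticolorable_cycleGraph_five_of_rotate (r : Fin 5)
    (h : IsMulticolorable (cycleGraph 5) (fun i => k (i + r)) n) :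
    IsMulticolorable (cycleGraph 5) k n := by
  have adj_sub : ∀ r i j : Fin 5,
      (cycleGraph 5).Adj i j → (cycleGraph 5).Adj (i - r) (j - r) := by decide
  let f : cycleGraph 5 →g cycleGraph 5 := ⟨fun i => i - r, adj_sub r _ _⟩
  simpa [Function.comp_def, f] using h.comap f

lemma isMulticolorable_cycleGraph_five_of_triple_le (h₄₀₁ : k 4 + k 0 + k 1 ≤ n)
    (h₁₂ : k 1 + k 2 ≤ n) (h₂₃ : k 2 + k 3 ≤ n) (h₃₄ : k 3 + k 4 ≤ n) :
    IsMulticolorable (cycleGraph 5) k n := by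
  refine isMulticolorable_cycleGraph_five_of_disjoint
    (A := ![Finset.Ico (k 1) (k 1 + k 0), Finset.Ico 0 (k 1), Finset.Ico (n - k 2) n,
      Finset.Ico 0 (k 3), Finset.Ico (n - k 4) n])
    (fun i c => ?_) (fun i => ?_) fun i => Finset.disjoint_left.2 fun c => ?_
  all_goals fin_cases i <;> simp <;> omega

lemma isMulticolorable_cycleGraph_five_of_lt_triple (h₀₁ : k 0 + k 1 ≤ n) (h₁₂ : k 1 + k 2 ≤ n)
    (h₄₀ : k 4 + k 0 ≤ n) (hsum : ∑ i, k i ≤ 2 * n) (h₀₁₂ : n < k 0 + k 1 + k 2)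
    (h₄₀₁ : n < k 4 + k 0 + k 1) : IsMulticolorable (cycleGraph 5) k n := by
  rw [Fin.sum_univ_five] at hsum
  refine isMulticolorable_cycleGraph_five_of_disjoint
    (A := ![Finset.Ico 0 (k 0), Finset.Ico (k 0) (k 0 + k 1),
      Finset.range n \ Finset.Ico (k 0 + k 1 + k 2 - n) (k 0 + k 1),
      Finset.Ico (k 0 + k 1 + k 2 - n) (k 0 + k 1 + k 2 - n + k 3), Finset.Ico (n - k 4) n])
    (fun i c => ?_) (fun i => ?_) fun i => Finset.disjoint_left.2 fun c => ?_
  · fin_cases i <;> simp <;> omega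
  · have card_two : k 2 ≤ (Finset.range n \
        Finset.Ico (k 0 + k 1 + k 2 - n) (k 0 + k 1)).card := by
      rw [Finset.card_sdiff_of_subset (fun c => by simp; omega)]
      simp only [Finset.card_range, Nat.card_Ico]
      omega
    fin_cases i <;> first | exact card_two | simp <;> omega
  · fin_cases i <;> simp <;> omega

/-- The two necessary conditions say that a colour is used at most once on an edge and at most
twice on the cycle. -/
theorem isMulticolorable_cycleGraph_five_iff : IsMulticolorable (cycleGraph 5) k n ↔
    (∀ i, k i + k (i + 1) ≤ n) ∧ ∑ i, k i ≤ 2 * n := by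
  constructor
  · intro h
    refine ⟨fun i => ?_, ?_⟩
    · have hne : i ≠ i + 1 := by simp
      rw [← Finset.sum_pair hne]
      refine h.sum_le_of_isClique ?_
      simp [cycleGraph_five_adj, hne]
    · rw [mul_comm]
      refine h.sum_le_mul fun s _ hs => ?_
      have hcard : ∀ s : Finset (Fin 5), (∀ i ∈ s, i + 1 ∉ s) → s.card ≤ 2 := by decide
      exact hcard s fun i hi hi' => hs hi hi' (by simp) (cycleGraph_five_adj.2 (.inl rfl))
  · rintro ⟨hpair, hsum⟩
    by_cases hr : ∃ r, k (r + 4) + k r + k (r + 1) ≤ n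
    · obtain ⟨r, hr⟩ := hr
      obtain ⟨h₂, h₃, h₄⟩ : 1 + r + 1 = 2 + r ∧ 2 + r + 1 = 3 + r ∧ 3 + r + 1 = 4 + r := by
        clear hr
        revert r
        decide
      refine isMulticolorable_cycleGraph_five_of_rotate r
        (isMulticolorable_cycleGraph_five_of_triple_le ?_ ?_ ?_ ?_)
      · simpa [add_comm] using hr
      · simpa only [h₂] using hpair (1 + r)
      · simpa only [h₃] using hpair (2 + r)
      · simpa only [h₄] using hpair (3 + r)
    · push Not at hr
      exact isMulticolorable_cycleGraph_five_of_lt_triple (hpair 0) (hpair 1) (hpair 4) hsum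
        (hr 1) (hr 0)

theorem isCriticalWeight_cycleGraph_five_iff (hk : ∀ i, 0 < k i) :
    IsCriticalWeight (cycleGraph 5) k m ↔ IsPattern m k := by
  have update_le : ∀ i j, Function.update k i (k i - 1) j ≤ k j := fun i j => by
    rcases eq_or_ne j i with rfl | hj <;> simp [*]
  constructor
  · intro h
    have pair_le : ∀ i, k i + k (i + 1) + 1 ≤ m := by
      intro i
      obtain ⟨n, rfl, hn⟩ := h.exists_isMulticolorable_update (i + 3)
      have hi := (by decide : ∀ i : Fin 5, i ≠ i + 3 ∧ i + 1 ≠ i + 3) i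
      simpa [Function.update_of_ne hi.1, Function.update_of_ne hi.2] using
        (isMulticolorable_cycleGraph_five_iff.1 hn).1 i
    obtain ⟨n, rfl, hn⟩ := h.exists_isMulticolorable_update 0
    have hle := (isMulticolorable_cycleGraph_five_iff.1 hn).2
    have hlt : 2 * n < ∑ i, k i := by
      by_contra! hlt
      have := h.le_of_isMulticolorable (isMulticolorable_cycleGraph_five_iff.2
        ⟨fun i => Nat.le_of_succ_le_succ (pair_le i), hlt⟩)
      omega
    have := sum_update_pred_add_one (hk 0)
    exact ⟨hk, pair_le, by omega⟩
  · rintro ⟨-, pair_le, hsum⟩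
    refine ⟨fun {n} hn => ?_, fun i => ⟨m - 1, ?_, ?_⟩⟩
    · have := (isMulticolorable_cycleGraph_five_iff.1 hn).2
      omega
    · have := pair_le 0
      omega
    · refine isMulticolorable_cycleGraph_five_iff.2 ⟨fun j => ?_, ?_⟩
      · have := pair_le j
        have := update_le i j
        have := update_le i (j + 1)
        omega
      · have := sum_update_pred_add_one (hk i)
        omega

end FiveCycle

/-! ### Substitution -/

section Substitution

variable {V ι κ : Type*} {G : SimpleGraph V} {Q : SimpleGraph ι} {R : SimpleGraph κ} {S : Set V}
  {π : V → ι} {ρ : ι → κ} {k : ι → ℕ} {m n : ℕ}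

/-- `G` is obtained from `Q` by substituting, for each vertex `i`, the graph that `G` induces on
the fibre of `π` over `i`. Fibres may be empty. -/
def IsSubstitution (G : SimpleGraph V) (Q : SimpleGraph ι) (π : V → ι) : Prop :=
  ∀ u v, π u ≠ π v → (G.Adj u v ↔ Q.Adj (π u) (π v))

namespace IsSubstitution

lemma comp (h : IsSubstitution G Q π) (h' : IsSubstitution Q R ρ) :
    IsSubstitution G R (ρ ∘ π) := fun u v huv =>
  (h u v fun e => huv (congrArg ρ e)).trans (h' _ _ huv)

lemma isIndContained (h : IsSubstitution G Q π) (hπ : π.Surjective) : Q ⊴ G := by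
  have hπ' := Function.surjInv_eq hπ
  refine ⟨⟨⟨Function.surjInv hπ, Function.injective_surjInv hπ⟩, fun {i j} => ?_⟩⟩
  rcases eq_or_ne i j with rfl | hij
  · simp
  · simpa [hπ'] using h (Function.surjInv hπ i) (Function.surjInv hπ j) (by simpa [hπ'])

lemma isMulticolorable_of_colorable (h : IsSubstitution G Q π)
    (hk : ∀ i n, (G.induce (S ∩ π ⁻¹' {i})).Colorable n → k i ≤ n)
    (hS : (G.induce S).Colorable n) : IsMulticolorable Q k n := by
  classical
  obtain ⟨c⟩ := hS
  let A : ι → Finset (Fin n) := fun i => Finset.univ.filter fun a =>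
    ∃ (u : V) (hu : u ∈ S), π u = i ∧ c ⟨u, hu⟩ = a
  refine ⟨A, fun i => hk i _ ?_, fun i j hij => Finset.disjoint_left.2 fun a hai haj => ?_⟩
  · let d : (G.induce (S ∩ π ⁻¹' {i})).Coloring (A i) := Coloring.mk
      (fun u => ⟨c ⟨u, u.2.1⟩, Finset.mem_filter.2 ⟨Finset.mem_univ _, u, u.2.1, u.2.2, rfl⟩⟩)
      fun {u v} huv e => c.valid (v := ⟨u, u.2.1⟩) (w := ⟨v, v.2.1⟩) huv (congrArg Subtype.val e)
    simpa using d.colorable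
  · obtain ⟨u, hu, rfl, rfl⟩ := (Finset.mem_filter.1 hai).2
    obtain ⟨v, hv, rfl, hvu⟩ := (Finset.mem_filter.1 haj).2
    exact c.valid (v := ⟨u, hu⟩) (w := ⟨v, hv⟩) ((h u v hij.ne).2 hij) hvu.symm

lemma colorable_of_isMulticolorable (h : IsSubstitution G Q π)
    (hk : ∀ i n, k i ≤ n → (G.induce (S ∩ π ⁻¹' {i})).Colorable n)
    (hQ : IsMulticolorable Q k n) : (G.induce S).Colorable n := by
  obtain ⟨A, hA, hd⟩ := hQ
  let c (i : ι) : (G.induce (S ∩ π ⁻¹' {i})).Coloring (A i) :=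
    (hk i _ (hA i)).toColoring (by simp)
  have valid_of_eq {i j : ι} (hij : i = j) {u v : V} (hu : u ∈ S ∩ π ⁻¹' {i})
      (hv : v ∈ S ∩ π ⁻¹' {j}) (huv : G.Adj u v) : (c i ⟨u, hu⟩ : Fin n) ≠ c j ⟨v, hv⟩ := by
    subst hij
    exact Subtype.coe_ne_coe.2 ((c i).valid (v := ⟨u, hu⟩) (w := ⟨v, hv⟩) huv)
  refine ⟨Coloring.mk (fun u => (c (π u) ⟨u, u.2, rfl⟩ : Fin n)) ?_⟩
  rintro ⟨u, hu⟩ ⟨v, hv⟩ (huv : G.Adj u v) e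
  by_cases hπ : π u = π v
  · exact valid_of_eq hπ ⟨hu, rfl⟩ ⟨hv, rfl⟩ huv e
  · exact Finset.disjoint_left.1 (hd _ _ ((h u v hπ).1 huv)) (c (π u) _).2
      (e ▸ (c (π v) ⟨v, hv, rfl⟩).2)

lemma colorable_induce_iff (h : IsSubstitution G Q π)
    (hk : ∀ i n, (G.induce (S ∩ π ⁻¹' {i})).Colorable n ↔ k i ≤ n) :
    (G.induce S).Colorable n ↔ IsMulticolorable Q k n :=
  ⟨h.isMulticolorable_of_colorable fun i n => (hk i n).1,
    h.colorable_of_isMulticolorable fun i n => (hk i n).2⟩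

theorem isCriticalOn_univ_iff [DecidableEq ι] (h : IsSubstitution G Q π) (hπ : π.Surjective)
    (hk : ∀ i, IsCriticalOn G (π ⁻¹' {i}) (k i)) :
    IsCriticalOn G Set.univ m ↔ IsCriticalWeight Q k m := by
  have colorable_iff {n : ℕ} : (G.induce Set.univ).Colorable n ↔ IsMulticolorable Q k n :=
    h.colorable_induce_iff fun i n => by rw [Set.univ_inter, (hk i).colorable_iff]
  have colorable_diff_iff {v : V} {n : ℕ} : (G.induce (Set.univ \ {v})).Colorable n ↔
      IsMulticolorable Q (Function.update k (π v) (k (π v) - 1)) n := by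
    refine h.colorable_induce_iff fun i n => ?_
    rw [← Set.inter_sdiff_right_comm, Set.univ_inter]
    rcases eq_or_ne i (π v) with rfl | hi
    · rw [(hk _).colorable_diff_iff rfl, Function.update_self]
    · rw [Set.sdiff_singleton_eq_self (show v ∉ π ⁻¹' {i} from Ne.symm hi), (hk i).colorable_iff,
        Function.update_of_ne hi]
  constructor
  · intro hG
    refine ⟨fun hn => hG.le_of_colorable (colorable_iff.2 hn), hπ.forall.2 fun v => ?_⟩
    obtain ⟨n, hnm, hn⟩ := hG.exists_colorable_diff (Set.mem_univ v)
    exact ⟨n, hnm, colorable_diff_iff.1 hn⟩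
  · intro hQ
    refine ⟨fun hn => hQ.le_of_isMulticolorable (colorable_iff.1 hn), fun {v} _ => ?_⟩
    obtain ⟨n, hnm, hn⟩ := hQ.exists_isMulticolorable_update (π v)
    exact ⟨n, hnm, colorable_diff_iff.2 hn⟩

/-- If deleting `v` did not lower the chromatic number of its fibre, then a colouring of `G - v`
would use enough colours on every fibre to colour `G`. -/
theorem exists_isCriticalOn_fibers (h : IsSubstitution G Q π) (hG : IsCriticalOn G Set.univ m) :
    ∃ k : ι → ℕ, ∀ i, IsCriticalOn G (π ⁻¹' {i}) (k i) := by
  have colorable (T : Set V) : (G.induce T).Colorable m :=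
    colorable_induce_mono T.subset_univ (hG.colorable_iff.2 le_rfl)
  have exists_least (T : Set V) : ∃ a, ∀ n, (G.induce T).Colorable n ↔ a ≤ n := by
    classical
    exact ⟨Nat.find ⟨m, colorable T⟩, fun n => ⟨Nat.find_min' _,
      (Nat.find_spec ⟨m, colorable T⟩).mono⟩⟩
  choose χ hχ using exists_least
  refine ⟨fun i => χ (π ⁻¹' {i}), fun i => ⟨(hχ _ _).1, fun {v} hv => ?_⟩⟩
  have hlt : χ (π ⁻¹' {i} \ {v}) < χ (π ⁻¹' {i}) := by
    by_contra! hle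
    obtain ⟨n, rfl, hn⟩ := hG.exists_colorable_diff (Set.mem_univ v)
    have hQ : IsMulticolorable Q (fun j => χ (π ⁻¹' {j})) n := by
      refine (h.isMulticolorable_of_colorable (fun j n => (hχ _ n).1) hn).anti fun j => ?_
      rw [← Set.inter_sdiff_right_comm, Set.univ_inter]
      rcases eq_or_ne j i with rfl | hj
      · exact hle
      · rw [Set.sdiff_singleton_eq_self
          (show v ∉ π ⁻¹' {j} from fun hv' => hj (Eq.trans (Eq.symm hv') hv))]
    exact Nat.not_succ_le_self n <| hG.le_of_colorable <| h.colorable_of_isMulticolorable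
      (fun j n => by rw [Set.univ_inter]; exact (hχ _ n).2) hQ
  exact ⟨χ (π ⁻¹' {i}) - 1, Nat.succ_pred_eq_of_pos (Nat.zero_lt_of_lt hlt),
    (hχ _ _).2 (Nat.le_pred_of_lt hlt)⟩

end IsSubstitution

end Substitution

/-! ### Perfection without five-cycles -/

section InducedPaths

variable {V : Type*} {G : SimpleGraph V} {a b c d e x : V}

/-- The condition on `H` makes every map that preserves and reflects adjacency injective. -/
lemma isIndContained_of_forall_lt {ι : Type*} [LinearOrder ι] {H : SimpleGraph ι}
    (hH : ∀ i j, i ≠ j → H.Adj i j ∨ ∃ k, ¬ (H.Adj i k ↔ H.Adj j k)) (f : ι → V)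
    (hf : ∀ i j, i < j → (H.Adj i j ↔ G.Adj (f i) (f j))) : H ⊴ G := by
  have hf' : ∀ i j, H.Adj i j ↔ G.Adj (f i) (f j) := by
    intro i j
    rcases lt_trichotomy i j with h | rfl | h
    · exact hf i j h
    · simp
    · rw [H.adj_comm, G.adj_comm]
      exact hf j i h
  refine ⟨⟨⟨f, fun i j hij => ?_⟩, fun {i j} => (hf' i j).symm⟩⟩
  by_contra hne
  rcases hH i j hne with h | ⟨k, hk⟩
  · exact ((hf' i j).1 h).ne hij
  · exact hk (by rw [hf', hf', hij])

instance : DecidableRel (pathGraph 5).Adj := fun _ _ => decidable_of_iff _ pathGraph_adj.symm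

lemma pathGraph_five_isIndContained (ab : G.Adj a b) (bc : G.Adj b c)
    (cd : G.Adj c d) (de : G.Adj d e) (ac : ¬ G.Adj a c) (ad : ¬ G.Adj a d) (ae : ¬ G.Adj a e)
    (bd : ¬ G.Adj b d) (be : ¬ G.Adj b e) (ce : ¬ G.Adj c e) : pathGraph 5 ⊴ G := by
  refine isIndContained_of_forall_lt (by decide) ![a, b, c, d, e] fun i j hij => ?_
  fin_cases i <;> fin_cases j <;> first | (exfalso; revert hij; decide) | simp [pathGraph_adj, *]

lemma compl_pathGraph_five_isIndContained (ab : ¬ G.Adj a b)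
    (bc : ¬ G.Adj b c) (cd : ¬ G.Adj c d) (de : ¬ G.Adj d e) (ac : G.Adj a c) (ad : G.Adj a d)
    (ae : G.Adj a e) (bd : G.Adj b d) (be : G.Adj b e) (ce : G.Adj c e) :
    (pathGraph 5)ᶜ ⊴ G := by
  refine isIndContained_of_forall_lt (by decide) ![a, b, c, d, e] fun i j hij => ?_
  fin_cases i <;> fin_cases j <;> first | (exfalso; revert hij; decide) | simp [pathGraph_adj, *]

lemma cycleGraph_five_isIndContained (ab : G.Adj a b) (bc : G.Adj b c)
    (cd : G.Adj c d) (de : G.Adj d e) (ae : G.Adj a e) (ac : ¬ G.Adj a c) (ad : ¬ G.Adj a d)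
    (bd : ¬ G.Adj b d) (be : ¬ G.Adj b e) (ce : ¬ G.Adj c e) : cycleGraph 5 ⊴ G := by
  refine isIndContained_of_forall_lt (by decide) ![a, b, c, d, e] fun i j hij => ?_
  fin_cases i <;> fin_cases j <;>
    first | (exfalso; revert hij; decide) | (rw [cycleGraph_five_adj]; simp [*])

/-- `G` has neither the path `P₅` nor its complement, the house, as an induced subgraph. -/
structure IsP5HouseFree (G : SimpleGraph V) : Prop where
  path : ¬ pathGraph 5 ⊴ G
  house : ¬ (pathGraph 5)ᶜ ⊴ G

lemma IsP5HouseFree.of_isIndContained {W : Type*} {H : SimpleGraph W} (hG : IsP5HouseFree G)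
    (h : H ⊴ G) : IsP5HouseFree H :=
  ⟨fun h' => hG.path (h'.trans h), fun h' => hG.house (h'.trans h)⟩

/-- The vertices `a, b, c, d` form, in this order, an induced path. -/
structure IsInducedP4 (G : SimpleGraph V) (a b c d : V) : Prop where
  ab : G.Adj a b
  bc : G.Adj b c
  cd : G.Adj c d
  ac : ¬ G.Adj a c
  ad : ¬ G.Adj a d
  bd : ¬ G.Adj b d

namespace IsInducedP4

lemma symm (h : IsInducedP4 G a b c d) : IsInducedP4 G d c b a :=
  ⟨h.cd.symm, h.bc.symm, h.ab.symm, fun h' => h.bd h'.symm, fun h' => h.ad h'.symm,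
    fun h' => h.ac h'.symm⟩

lemma adj_and_not_adj_of_adj_end (h : IsInducedP4 G a b c d) (hG : IsP5HouseFree G)
    (hC₅ : ¬ cycleGraph 5 ⊴ G) (xa : G.Adj x a) (xb : ¬ G.Adj x b) :
    G.Adj x c ∧ ¬ G.Adj x d := by
  obtain ⟨ab, bc, cd, ac, ad, bd⟩ := h
  by_cases xc : G.Adj x c <;> by_cases xd : G.Adj x d
  · exact absurd (compl_pathGraph_five_isIndContained xb bd (ad ·.symm) ac xd xa xc ab.symm bc
      cd.symm) hG.house
  · exact ⟨xc, xd⟩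
  · exact absurd (cycleGraph_five_isIndContained xa ab bc cd xd xb xc ac ad bd) hC₅
  · exact absurd (pathGraph_five_isIndContained xa ab bc cd xb xc xd ac ad bd) hG.path

lemma neighborFinset_sdiff_ssubset [Fintype V] [DecidableEq V] [DecidableRel G.Adj]
    (h : IsInducedP4 G a b c d) (hG : IsP5HouseFree G) (hC₅ : ¬ cycleGraph 5 ⊴ G) :
    G.neighborFinset a \ G.neighborFinset b ⊂ G.neighborFinset c \ G.neighborFinset d := by
  refine (Finset.ssubset_iff_of_subset fun x hx => ?_).2 ⟨d, by simp [h.cd], by simp [h.ad]⟩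
  simp only [Finset.mem_sdiff, mem_neighborFinset] at hx ⊢
  obtain ⟨xc, xd⟩ :=
    h.adj_and_not_adj_of_adj_end hG hC₅ hx.1.symm fun h' => hx.2 h'.symm
  exact ⟨xc.symm, fun h' => xd h'.symm⟩

lemma degree_lt_of_degree_le [Fintype V] [DecidableRel G.Adj] (h : IsInducedP4 G a b c d)
    (hG : IsP5HouseFree G) (hC₅ : ¬ cycleGraph 5 ⊴ G) (hba : G.degree b ≤ G.degree a) :
    G.degree d < G.degree c := by
  classical
  have card_sdiff_add (u v : V) := Finset.card_sdiff_add_card (G.neighborFinset u)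
    (G.neighborFinset v)
  have hab := card_sdiff_add a b
  have hba' := card_sdiff_add b a
  have hcd := card_sdiff_add c d
  have hdc := card_sdiff_add d c
  rw [Finset.union_comm] at hba' hdc
  simp only [card_neighborFinset_eq_degree] at hab hba' hcd hdc
  have := Finset.card_lt_card (h.neighborFinset_sdiff_ssubset hG hC₅)
  have := Finset.card_lt_card (h.symm.neighborFinset_sdiff_ssubset hG hC₅)
  omega

end IsInducedP4

end InducedPaths

section PerfectOrder

variable {V : Type*} [LinearOrder V] {G : SimpleGraph V}

/-- A perfect order in the sense of Chvátal: no induced path `a b c d` has `a < b` and `d < c`. -/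
def IsPerfectOrder (G : SimpleGraph V) : Prop :=
  ∀ a b c d, IsInducedP4 G a b c d → a < b → ¬ d < c

/-- Let `p u` be the smallest of the neighbours, and let `p v` be adjacent to all the members of `C`
that `p u` is not adjacent to. If `p v` is not adjacent to `w`, then `p v, v, w, p u` is an
obstruction. -/
lemma IsPerfectOrder.exists_forall_adj (hG : IsPerfectOrder G) (p : V → V) {C : Finset V}
    (hne : C.Nonempty) (hC : G.IsClique C) (hp : ∀ v ∈ C, G.Adj (p v) v ∧ p v < v)
    (hS : ∀ u ∈ C, ∀ v ∈ C, ¬ G.Adj (p u) (p v)) : ∃ u ∈ C, ∀ v ∈ C, G.Adj (p u) v := by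
  classical
  induction C using Finset.strongInduction with
  | H C ih =>
    obtain ⟨u, hu, hmin⟩ := C.exists_min_image p hne
    by_cases! hall : ∀ v ∈ C, G.Adj (p u) v
    · exact ⟨u, hu, hall⟩
    obtain ⟨w₀, hw₀, hw₀'⟩ := hall
    have hsub := Finset.filter_subset (fun v => ¬ G.Adj (p u) v) C
    obtain ⟨v, hv, hcomp⟩ := ih _
      (Finset.filter_ssubset.2 ⟨u, hu, not_not.2 (hp u hu).1⟩)
      ⟨w₀, Finset.mem_filter.2 ⟨hw₀, hw₀'⟩⟩ (hC.subset (Finset.coe_subset.2 hsub))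
      (fun a ha => hp a (hsub ha)) (fun a ha b hb => hS a (hsub ha) b (hsub hb))
    obtain ⟨hvC, huv⟩ := Finset.mem_filter.1 hv
    refine ⟨v, hvC, fun w hw => ?_⟩
    by_contra hvw
    have huw : G.Adj (p u) w := by
      by_contra h
      exact hvw (hcomp w (Finset.mem_filter.2 ⟨hw, h⟩))
    have hne : v ≠ w := by
      rintro rfl
      exact huv huw
    exact hG (p v) v w (p u) ⟨(hp v hvC).1, hC hvC hw hne, huw.symm, hvw, hS v hvC u hu,
      fun h => huv h.symm⟩ (hp v hvC).2 ((hmin w hw).trans_lt (hp w hw).2)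

lemma exists_greedy_coloring [Finite V] (G : SimpleGraph V) :
    ∃ c : G.Coloring ℕ, ∀ v, ∀ a < c v, ∃ u < v, G.Adj u v ∧ c u = a := by
  let c : V → ℕ := wellFounded_lt.fix fun v ih =>
    sInf {a | ∀ u, (h : u < v) → G.Adj u v → ih u h ≠ a}
  have c_eq (v : V) : c v = sInf {a | ∀ u < v, G.Adj u v → c u ≠ a} := WellFounded.fix_eq _ _ v
  have c_ne {u v : V} (huv : G.Adj u v) (hlt : u < v) : c u ≠ c v := by
    have hne : {a | ∀ u < v, G.Adj u v → c u ≠ a}.Nonempty := by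
      obtain ⟨a, ha⟩ := (Set.finite_range c).exists_notMem
      exact ⟨a, fun u _ _ h => ha ⟨u, h⟩⟩
    rw [c_eq v]
    exact Nat.sInf_mem hne u hlt huv
  refine ⟨Coloring.mk c fun {u v} huv => ?_, fun v a (ha : a < c v) => ?_⟩
  · exact huv.ne.lt_or_gt.elim (c_ne huv) fun h => (c_ne huv.symm h).symm
  · rw [c_eq v] at ha
    have hmem := Nat.notMem_of_lt_sInf ha
    simp only [Set.mem_ofPred_eq, not_forall, not_not] at hmem
    obtain ⟨u, hu, huv, rfl⟩ := hmem
    exact ⟨u, hu, huv, rfl⟩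

lemma IsPerfectOrder.exists_isNClique_of_greedy (hG : IsPerfectOrder G) {c : G.Coloring ℕ}
    (hc : ∀ v, ∀ a < c v, ∃ u < v, G.Adj u v ∧ c u = a) (v : V) {j : ℕ} (hj : j ≤ c v) :
    ∃ C : Finset V, G.IsNClique (j + 1) C ∧ ∀ u ∈ C, c v ≤ c u + j := by
  classical
  induction j with
  | zero => exact ⟨{v}, by simp, by simp⟩
  | succ j ih =>
    obtain ⟨C, hC, hcol⟩ := ih (by omega)
    have exists_lt : ∀ u ∈ C, ∃ w < u, G.Adj w u ∧ c w = c v - (j + 1) := fun u hu =>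
      hc u _ (by have := hcol u hu; omega)
    choose! p hlt hadj hcp using exists_lt
    obtain ⟨u, hu, hcomp⟩ := hG.exists_forall_adj p
      (Finset.card_pos.1 (by rw [hC.card_eq]; omega)) hC.isClique
      (fun w hw => ⟨hadj w hw, hlt w hw⟩)
      (fun a ha b hb h => c.valid h ((hcp a ha).trans (hcp b hb).symm))
    refine ⟨insert (p u) C, hC.insert hcomp, Finset.forall_mem_insert _ _ _ |>.2 ⟨?_, ?_⟩⟩
    · have := hcp u hu
      omega
    · intro w hw
      have := hcol w hw
      omega

theorem IsPerfectOrder.exists_isNClique [Finite V] (hG : IsPerfectOrder G) :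
    ∃ (n : ℕ) (C : Finset V), G.Colorable n ∧ G.IsNClique n C := by
  obtain ⟨c, hc⟩ := exists_greedy_coloring G
  cases isEmpty_or_nonempty V
  · exact ⟨0, ∅, .of_isEmpty 0, by simp⟩
  · obtain ⟨v, hv⟩ := Finite.exists_max c
    obtain ⟨C, hC, -⟩ := hG.exists_isNClique_of_greedy hc v le_rfl
    exact ⟨c v + 1, C, (colorable_iff_exists_bdd_nat_coloring _).2
      ⟨c, fun u => Nat.lt_succ_of_le (hv u)⟩, hC⟩

end PerfectOrder

section Perfection

variable {V ι : Type*} {G : SimpleGraph V} {Q : SimpleGraph ι} {k : ι → ℕ} {m n : ℕ}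

/-- The perfect order is by decreasing degree. -/
theorem IsP5HouseFree.exists_isNClique [Finite V] (hG : IsP5HouseFree G)
    (hC₅ : ¬ cycleGraph 5 ⊴ G) : ∃ (n : ℕ) (C : Finset V), G.Colorable n ∧ G.IsNClique n C := by
  classical
  have := Fintype.ofFinite V
  let r : V → ℕᵒᵈ ×ₗ Fin (Fintype.card V) := fun v =>
    toLex (OrderDual.toDual (G.degree v), Fintype.equivFin V v)
  have hr : Function.Injective r := fun u v h => by
    simpa [r] using congrArg (fun x => (ofLex x).2) h
  let _ : LinearOrder V := LinearOrder.lift' r hr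
  have degree_le_of_lt {u v : V} (h : u < v) : G.degree v ≤ G.degree u := by
    rcases Prod.Lex.lt_iff.1 (show r u < r v from h) with h | h
    · exact (OrderDual.toDual_lt_toDual.1 h).le
    · exact (OrderDual.toDual_inj.1 h.1).ge
  exact IsPerfectOrder.exists_isNClique fun a b c d h hab hdc =>
    (h.degree_lt_of_degree_le hG hC₅ (degree_le_of_lt hab)).not_ge (degree_le_of_lt hdc)

/-- The graph obtained from `Q` by substituting a clique on `k i` vertices for each vertex `i`. -/
def cliqueBlowup (Q : SimpleGraph ι) (k : ι → ℕ) : SimpleGraph (Σ i, Fin (k i)) where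
  Adj x y := x ≠ y ∧ (x.1 = y.1 ∨ Q.Adj x.1 y.1)
  symm := ⟨fun _ _ h => ⟨h.1.symm, h.2.imp Eq.symm Adj.symm⟩⟩
  loopless := ⟨fun _ h => h.1 rfl⟩

lemma cliqueBlowup_isSubstitution : IsSubstitution (cliqueBlowup Q k) Q Sigma.fst :=
  fun _ _ hxy => ⟨fun h => h.2.resolve_left hxy,
    fun h => ⟨fun e => hxy (congrArg Sigma.fst e), .inr h⟩⟩

/-- Substituting cliques only creates true twins, hence no new induced copy of a graph without
true twins. -/
lemma isIndContained_of_cliqueBlowup {κ : Type*} {H : SimpleGraph κ}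
    (hH : ∀ i j, H.Adj i j → ∃ l, l ≠ i ∧ l ≠ j ∧ ¬ (H.Adj i l ↔ H.Adj j l))
    (h : H ⊴ cliqueBlowup Q k) : H ⊴ Q := by
  obtain ⟨f⟩ := h
  have adj_iff : ∀ i j, H.Adj i j ↔ f i ≠ f j ∧ ((f i).1 = (f j).1 ∨ Q.Adj (f i).1 (f j).1) :=
    fun i j => f.map_rel_iff.symm
  have hinj : Function.Injective fun i => (f i).1 := by
    intro i j (hij : (f i).1 = (f j).1)
    by_contra hne
    obtain ⟨l, hli, hlj, hl⟩ := hH i j ((adj_iff i j).2 ⟨f.injective.ne hne, .inl hij⟩)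
    refine hl ?_
    rw [adj_iff, adj_iff, hij]
    simp [f.injective.ne hli.symm, f.injective.ne hlj.symm]
  refine ⟨⟨⟨_, hinj⟩, fun {i j} => ?_⟩⟩
  rcases eq_or_ne i j with rfl | hij
  · simp
  · exact (cliqueBlowup_isSubstitution _ _ (hinj.ne hij)).symm.trans f.map_rel_iff

lemma isMulticolorable_of_cliqueBlowup_colorable (h : (cliqueBlowup Q k).Colorable n) :
    IsMulticolorable Q k n := by
  refine cliqueBlowup_isSubstitution.isMulticolorable_of_colorable (S := Set.univ)
    (fun i l hl => ?_) (h.of_hom (Embedding.induce Set.univ).toHom)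
  let f : (⊤ : SimpleGraph (Fin (k i))) →g
      (cliqueBlowup Q k).induce (Set.univ ∩ Sigma.fst ⁻¹' {i}) :=
    ⟨fun a => ⟨⟨i, a⟩, trivial, rfl⟩, fun hab => ⟨by simpa using hab, .inl rfl⟩⟩
  simpa using (hl.of_hom f).chromaticNumber_le

theorem IsP5HouseFree.exists_isClique_isMulticolorable [Finite ι] (hQ : IsP5HouseFree Q)
    (hC₅ : ¬ cycleGraph 5 ⊴ Q) (k : ι → ℕ) :
    ∃ C : Finset ι, Q.IsClique C ∧ IsMulticolorable Q k (∑ i ∈ C, k i) := by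
  classical
  have hfree : IsP5HouseFree (cliqueBlowup Q k) :=
    ⟨fun h => hQ.path (isIndContained_of_cliqueBlowup (by decide) h),
      fun h => hQ.house (isIndContained_of_cliqueBlowup (by decide) h)⟩
  obtain ⟨n, C, hn, hC⟩ := hfree.exists_isNClique
    fun h => hC₅ (isIndContained_of_cliqueBlowup (by decide) h)
  have hle : n ≤ ∑ i ∈ C.image Sigma.fst, k i := by
    have hsub : C ⊆ (C.image Sigma.fst).sigma fun _ => Finset.univ := fun x hx => by
      simpa using ⟨x.2, hx⟩
    simpa [hC.card_eq, Finset.card_sigma] using Finset.card_le_card hsub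
  refine ⟨C.image Sigma.fst, ?_, isMulticolorable_of_cliqueBlowup_colorable (hn.mono hle)⟩
  intro u hu v hv huv
  obtain ⟨x, hx, rfl⟩ := Finset.mem_image.1 hu
  obtain ⟨y, hy, rfl⟩ := Finset.mem_image.1 hv
  exact (hC.isClique hx hy fun e => huv (congrArg _ e)).2.resolve_left huv

theorem IsCriticalWeight.eq_top [Finite ι] [DecidableEq ι] (h : IsCriticalWeight Q k m)
    (hQ : IsP5HouseFree Q) (hC₅ : ¬ cycleGraph 5 ⊴ Q) : Q = ⊤ := by
  obtain ⟨C, hC, hk⟩ := hQ.exists_isClique_isMulticolorable hC₅ k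
  have mem_C (i : ι) : i ∈ C := by
    by_contra hi
    obtain ⟨n, rfl, hn⟩ := h.exists_isMulticolorable_update i
    have hsum := hn.sum_le_of_isClique hC
    rw [Finset.sum_update_of_notMem hi] at hsum
    have := h.le_of_isMulticolorable hk
    omega
  ext i j
  exact ⟨Adj.ne, fun hij => hC (mem_C i) (mem_C j) hij⟩

end Perfection

/-! ### Decomposition into joins and buoys -/

section PartialBuoy

variable {ι : Type*} {Q : SimpleGraph ι} {c : ι → Option (Fin 5)} {t : Fin 5 → ι} {x : ι}
  {i : Fin 5}

lemma IsP5HouseFree.forall_adj_cycle_or (hQ : IsP5HouseFree Q)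
    (ht : ∀ i j, Q.Adj (t i) (t j) ↔ (cycleGraph 5).Adj i j) (x : ι) :
    (∀ i, ¬ Q.Adj x (t i)) ∨ (∀ i, Q.Adj x (t i)) ∨
      ∃ i, ∀ j, j ≠ i → (Q.Adj x (t j) ↔ (cycleGraph 5).Adj i j) := by
  have trichotomy : ∀ s : Fin 5 → Bool,
      (∀ i, s i → s (i + 1) ∨ s (i + 2) ∨ s (i + 3)) →
      (∀ i, s (i + 2) → s (i + 4) → s (i + 1) → s i) →
      (∀ i, ¬ s i) ∨ (∀ i, s i) ∨
        ∃ i, ∀ j, j ≠ i → (s j = true ↔ (cycleGraph 5).Adj i j) := by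
    decide
  classical
  have no_path (i : Fin 5) (a : Q.Adj x (t i)) :
      Q.Adj x (t (i + 1)) ∨ Q.Adj x (t (i + 2)) ∨ Q.Adj x (t (i + 3)) := by
    by_contra! ⟨b, c, d⟩
    refine hQ.path (pathGraph_five_isIndContained a ?_ ?_ ?_ b c d ?_ ?_ ?_) <;>
      rw [ht] <;> clear a b c d <;> revert i <;> decide
  have no_house (i : Fin 5) (b : Q.Adj x (t (i + 2))) (c : Q.Adj x (t (i + 4)))
      (d : Q.Adj x (t (i + 1))) : Q.Adj x (t i) := by
    by_contra a
    refine hQ.house (compl_pathGraph_five_isIndContained a ?_ ?_ ?_ b c d ?_ ?_ ?_) <;>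
      rw [ht] <;> clear a b c d <;> revert i <;> decide
  simpa using trichotomy (fun i => decide (Q.Adj x (t i))) (by simpa using no_path)
    (by simpa using no_house)

/-- The partial map `c` to the five-cycle exhibits the graph induced on its domain as a buoy. -/
structure IsPartialBuoy (Q : SimpleGraph ι) (c : ι → Option (Fin 5)) : Prop where
  exists_eq_some : ∀ i, ∃ v, c v = some i
  adj_iff : ∀ {u v i j}, c u = some i → c v = some j → i ≠ j →
    (Q.Adj u v ↔ (cycleGraph 5).Adj i j)

lemma exists_isPartialBuoy (h : cycleGraph 5 ⊴ Q) : ∃ c, IsPartialBuoy Q c := by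
  obtain ⟨f⟩ := h
  have hf := Function.Injective.isPartialInv f.injective
  refine ⟨Function.partialInv f, fun i => ⟨f i, (hf _ _).2 rfl⟩, fun hu hv _ => ?_⟩
  rw [← (hf _ _).1 hu, ← (hf _ _).1 hv]
  exact f.map_rel_iff

lemma update_transversal (ht : ∀ l, c (t l) = some l) (hx : c x = some i) (l : Fin 5) :
    c (Function.update t i x l) = some l := by
  rcases eq_or_ne l i with rfl | hl
  · simpa using hx
  · simpa [hl] using ht l

namespace IsPartialBuoy

lemma adj_transversal_iff (hc : IsPartialBuoy Q c) (ht : ∀ l, c (t l) = some l) (i j : Fin 5) :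
    Q.Adj (t i) (t j) ↔ (cycleGraph 5).Adj i j := by
  rcases eq_or_ne i j with rfl | hij
  · simp
  · exact hc.adj_iff (ht i) (ht j) hij

lemma adj_iff_of_twin (hc : IsPartialBuoy Q c) (hQ : IsP5HouseFree Q)
    (ht : ∀ l, c (t l) = some l) (hx : ∀ l, l ≠ i → (Q.Adj x (t l) ↔ (cycleGraph 5).Adj i l))
    {v : ι} {j : Fin 5} (hv : c v = some j) (hij : j ≠ i) :
    Q.Adj x v ↔ (cycleGraph 5).Adj i j := by
  have twin_of_three : ∀ i j : Fin 5, j ≠ i → ∀ s : Fin 5 → Bool,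
      (∀ l, ¬ s l) ∨ (∀ l, s l) ∨ (∃ i, ∀ l, l ≠ i → (s l = true ↔ (cycleGraph 5).Adj i l)) →
      (∀ l, l ≠ i → l ≠ j → (s l = true ↔ (cycleGraph 5).Adj i l)) →
      (s j = true ↔ (cycleGraph 5).Adj i j) := by
    decide
  classical
  simpa using twin_of_three i j hij (fun l => decide (Q.Adj x (Function.update t j v l)))
    (by simpa using hQ.forall_adj_cycle_or (hc.adj_transversal_iff (update_transversal ht hv)) x)
    (fun l hl hlj => by simpa [hlj] using hx l hl)

lemma update [DecidableEq ι] (hc : IsPartialBuoy Q c) (hQ : IsP5HouseFree Q)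
    (ht : ∀ l, c (t l) = some l) (hxc : c x = none)
    (hx : ∀ l, l ≠ i → (Q.Adj x (t l) ↔ (cycleGraph 5).Adj i l)) :
    IsPartialBuoy Q (Function.update c x (some i)) := by
  refine ⟨fun j => ⟨t j, ?_⟩, fun {u v a b} hu hv hab => ?_⟩
  · rw [Function.update_of_ne, ht]
    rintro rfl
    simp [ht] at hxc
  · rcases eq_or_ne x u with rfl | hxu <;> rcases eq_or_ne x v with rfl | hxv
    · exact absurd (Option.some.inj (hu.symm.trans hv)) hab
    · rw [Function.update_self] at hu
      rw [Function.update_of_ne hxv.symm] at hv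
      obtain rfl := Option.some.inj hu
      exact hc.adj_iff_of_twin hQ ht hx hv hab.symm
    · rw [Function.update_self] at hv
      rw [Function.update_of_ne hxu.symm] at hu
      obtain rfl := Option.some.inj hv
      rw [Q.adj_comm, (cycleGraph 5).adj_comm]
      exact hc.adj_iff_of_twin hQ ht hx hu hab
    · rw [Function.update_of_ne hxu.symm] at hu
      rw [Function.update_of_ne hxv.symm] at hv
      exact hc.adj_iff hu hv hab

end IsPartialBuoy

/-- Take a partial buoy of maximal size: a vertex outside it that looked like a vertex of the
five-cycle could be added to it. -/
lemma IsP5HouseFree.exists_isPartialBuoy_of_maximal [Finite ι] (hQ : IsP5HouseFree Q)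
    (hC₅ : cycleGraph 5 ⊴ Q) : ∃ c, IsPartialBuoy Q c ∧ ∀ x, c x = none →
      ∀ t : Fin 5 → ι, (∀ l, c (t l) = some l) →
        (∀ l, ¬ Q.Adj x (t l)) ∨ (∀ l, Q.Adj x (t l)) := by
  classical
  have : Nonempty {c // IsPartialBuoy Q c} := nonempty_subtype.2 (exists_isPartialBuoy hC₅)
  obtain ⟨⟨c, hc⟩, hmax⟩ := Finite.exists_max fun c : {c // IsPartialBuoy Q c} =>
    {v | c.1 v ≠ none}.ncard
  refine ⟨c, hc, fun x hx t ht => ?_⟩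
  rcases hQ.forall_adj_cycle_or (hc.adj_transversal_iff ht) x with h | h | ⟨i, hi⟩
  · exact .inl h
  · exact .inr h
  · refine absurd (hmax ⟨_, hc.update hQ ht hx hi⟩) (not_le.2 (Set.ncard_lt_ncard ?_))
    refine (Set.ssubset_iff_of_subset fun v (hv : c v ≠ none) => ?_).2 ⟨x, by simp, fun h => h hx⟩
    have hvx : v ≠ x := by
      rintro rfl
      exact hv hx
    simpa [hvx] using hv

/-- Every vertex outside `S` is adjacent to all of `S` or to none of it. -/
def IsHomogeneous (Q : SimpleGraph ι) (S : Set ι) : Prop :=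
  ∀ x ∉ S, ∀ u ∈ S, ∀ v ∈ S, (Q.Adj x u ↔ Q.Adj x v)

lemma IsP5HouseFree.exists_isPartialBuoy_isHomogeneous [Finite ι] (hQ : IsP5HouseFree Q)
    (hC₅ : cycleGraph 5 ⊴ Q) : ∃ c, IsPartialBuoy Q c ∧ IsHomogeneous Q {v | c v ≠ none} := by
  obtain ⟨c, hc, hmax⟩ := hQ.exists_isPartialBuoy_of_maximal hC₅
  choose t ht using hc.exists_eq_some
  suffices adj_iff : ∀ x, c x = none → ∀ u, c u ≠ none → (Q.Adj x u ↔ Q.Adj x (t 0)) from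
    ⟨c, hc, fun x hx u hu v hv =>
      (adj_iff x (not_not.1 hx) u hu).trans (adj_iff x (not_not.1 hx) v hv).symm⟩
  intro x hx u hu
  obtain ⟨j, hj⟩ := Option.ne_none_iff_exists'.1 hu
  have h₀ : Q.Adj x (t 0) ↔ Q.Adj x (t (j + 1)) := by
    rcases hmax x hx t ht with h | h <;> simp [h]
  have hu : Q.Adj x (Function.update t j u j) ↔ Q.Adj x (Function.update t j u (j + 1)) := by
    rcases hmax x hx _ (update_transversal ht hj) with h | h <;> simp only [h]
  rw [h₀]
  simpa using hu

lemma IsHomogeneous.exists_isSubstitution {S : Set ι} (hS : IsHomogeneous Q S) {t : ι}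
    (ht : t ∈ S) : ∃ ρ : ι → ↥(insert t Sᶜ), ρ.Surjective ∧
      IsSubstitution Q (Q.induce (insert t Sᶜ)) ρ := by
  classical
  let ρ (x : ι) : ↥(insert t Sᶜ) := if hx : x ∈ S then ⟨t, .inl rfl⟩ else ⟨x, .inr hx⟩
  refine ⟨ρ, fun y => ⟨y, ?_⟩, fun u v huv => ?_⟩
  · obtain ⟨y, rfl | hy⟩ := y
    · simp [ρ, ht]
    · simp [ρ, show y ∉ S from hy]
  · by_cases hu : u ∈ S <;> by_cases hv : v ∈ S
    · simp [ρ, hu, hv] at huv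
    · simpa [ρ, hu, hv, Q.adj_comm] using hS v hv u hu t ht
    · simpa [ρ, hu, hv] using hS u hu v hv t ht
    · simp [ρ, hu, hv]

end PartialBuoy

section Decomposition

universe u

/-- Contract maximal buoys, which are homogeneous, until one of them is everything or no five-cycle
is left. -/
theorem IsP5HouseFree.exists_isSubstitution {ι : Type u} [Finite ι] [Nontrivial ι]
    {Q : SimpleGraph ι} (hQ : IsP5HouseFree Q) :
    (∃ ρ : ι → Fin 5, ρ.Surjective ∧ IsSubstitution Q (cycleGraph 5) ρ) ∨
      ∃ (κ : Type u) (_ : Finite κ) (_ : Nontrivial κ) (R : SimpleGraph κ) (ρ : ι → κ),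
        ρ.Surjective ∧ IsSubstitution Q R ρ ∧ ¬ cycleGraph 5 ⊴ R := by
  induction hn : Nat.card ι using Nat.strong_induction_on generalizing ι with
  | _ n ih =>
  by_cases hC₅ : cycleGraph 5 ⊴ Q
  · obtain ⟨c, hc, hhom⟩ := hQ.exists_isPartialBuoy_isHomogeneous hC₅
    by_cases! hall : ∀ x, c x ≠ none
    · choose p hp using fun x => Option.ne_none_iff_exists'.1 (hall x)
      refine .inl ⟨p, fun i => ?_, fun u v huv => hc.adj_iff (hp u) (hp v) huv⟩
      obtain ⟨v, hv⟩ := hc.exists_eq_some i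
      exact ⟨v, Option.some.inj ((hp v).symm.trans hv)⟩
    · obtain ⟨x, hx⟩ := hall
      obtain ⟨t, ht⟩ := hc.exists_eq_some 0
      obtain ⟨t', ht'⟩ := hc.exists_eq_some 1
      obtain ⟨ρ, hρ, hsub⟩ := hhom.exists_isSubstitution (t := t) (by simp [ht])
      have hnt : Nontrivial ↥(insert t {v | c v ≠ none}ᶜ) :=
        ⟨⟨t, .inl rfl⟩, ⟨x, .inr (not_not.2 hx)⟩, by rintro ⟨⟩; simp [hx] at ht⟩
      have hlt : Nat.card ↥(insert t {v | c v ≠ none}ᶜ) < n := by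
        rw [← hn]
        refine Set.ncard_lt_card (Set.ne_univ_iff_exists_notMem _ |>.2 ⟨t', ?_⟩)
        rintro (rfl | h)
        · simp [ht] at ht'
        · exact h (by simp [ht'])
      obtain ⟨σ, hσ, hsub'⟩ | ⟨κ, h₁, h₂, R, σ, hσ, hsub', hR⟩ :=
        ih _ hlt (hQ.of_isIndContained (hsub.isIndContained hρ)) rfl
      · exact .inl ⟨σ ∘ ρ, hσ.comp hρ, hsub.comp hsub'⟩
      · exact .inr ⟨κ, h₁, h₂, R, σ ∘ ρ, hσ.comp hρ, hsub.comp hsub', hR⟩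
  · exact .inr ⟨ι, ‹_›, ‹_›, Q, id, Function.surjective_id, fun _ _ _ => Iff.rfl, hC₅⟩

variable {V : Type*} {G : SimpleGraph V} {m : ℕ}

lemma IsCriticalOn.nontrivial (hG : IsCriticalOn G Set.univ m) (hm : 2 ≤ m) : Nontrivial V := by
  rw [← not_subsingleton_iff_nontrivial]
  intro hV
  have : (G.induce Set.univ).Colorable 1 :=
    ⟨Coloring.mk (fun _ => 0) fun {u v} huv => absurd (Subsingleton.elim u v) huv.ne⟩
  have := hG.le_of_colorable this
  omega

theorem IsCriticalOn.exists_isSubstitution [Finite V] (hG : IsCriticalOn G Set.univ m) (hm : 2 ≤ m)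
    (hfree : IsP5HouseFree G) :
    (∃ π : V → Bool, π.Surjective ∧ IsSubstitution G ⊤ π) ∨
      ∃ π : V → Fin 5, π.Surjective ∧ IsSubstitution G (cycleGraph 5) π := by
  classical
  have := hG.nontrivial hm
  obtain h | ⟨κ, _, _, R, ρ, hρ, hsub, hR⟩ := hfree.exists_isSubstitution
  · exact .inr h
  · obtain ⟨k, hk⟩ := hsub.exists_isCriticalOn_fibers hG
    obtain rfl : R = ⊤ := ((hsub.isCriticalOn_univ_iff hρ hk).1 hG).eq_top
      (hfree.of_isIndContained (hsub.isIndContained hρ)) hR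
    obtain ⟨a, b, hab⟩ := exists_pair_ne κ
    have hsub' : IsSubstitution (⊤ : SimpleGraph κ) (⊤ : SimpleGraph Bool) (decide <| · = a) :=
      fun u v huv => iff_of_true (fun e => huv (by rw [e])) huv
    exact .inl ⟨_, Function.Surjective.comp
      (Bool.forall_bool.2 ⟨⟨b, by simpa using hab.symm⟩, ⟨a, by simp⟩⟩) hρ, hsub.comp hsub'⟩

end Decomposition

section InducedCopies

variable {V W ι : Type*} {G : SimpleGraph V} {H : SimpleGraph W} {Q : SimpleGraph ι}
  {π : V → ι} {ρ : W → ι} {S : Set V} {k n : ℕ}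

lemma colorable_induce_image_iff (f : G ↪g H) :
    (H.induce (f '' S)).Colorable n ↔ (G.induce S).Colorable n := by
  have e := (f.comp (Embedding.induce S)).isoInduceRange
  have range_eq : Set.range (f.comp (Embedding.induce S)) = f '' S :=
    (Set.range_comp f Subtype.val).trans (congrArg _ Subtype.range_coe)
  rw [range_eq] at e
  exact (colorable_congr e).symm

lemma isCriticalOn_image_iff (f : G ↪g H) : IsCriticalOn H (f '' S) k ↔ IsCriticalOn G S k := by
  have colorable_diff_iff {v : V} {n : ℕ} :
      (H.induce (f '' S \ {f v})).Colorable n ↔ (G.induce (S \ {v})).Colorable n := by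
    rw [← colorable_induce_image_iff f, Set.image_sdiff f.injective, Set.image_singleton]
  constructor
  · refine fun h => ⟨fun hn => h.le_of_colorable ((colorable_induce_image_iff f).2 hn),
      fun {v} hv => ?_⟩
    obtain ⟨n, hn, hc⟩ := h.exists_colorable_diff (Set.mem_image_of_mem f hv)
    exact ⟨n, hn, colorable_diff_iff.1 hc⟩
  · refine fun h => ⟨fun hn => h.le_of_colorable ((colorable_induce_image_iff f).1 hn), ?_⟩
    rintro _ ⟨v, hv, rfl⟩
    obtain ⟨n, hn, hc⟩ := h.exists_colorable_diff hv
    exact ⟨n, hn, colorable_diff_iff.2 hc⟩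

lemma isCriticalOn_induce_univ_iff :
    IsCriticalOn (G.induce S) Set.univ k ↔ IsCriticalOn G S k := by
  have image_univ : Embedding.induce (G := G) S '' Set.univ = S :=
    Set.image_univ.trans Subtype.range_coe
  rw [← isCriticalOn_image_iff (Embedding.induce S), image_univ]

/-- Every homogeneous set of vertices is trivial. Such a graph can only embed into a substitution
by embedding into the quotient or into a fibre. -/
def IsPrime (H : SimpleGraph W) : Prop :=
  ∀ S, IsHomogeneous H S → S.Subsingleton ∨ S = Set.univ

lemma IsPrime.compl (hH : IsPrime H) : IsPrime Hᶜ := by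
  refine fun S hS => hH S fun x hx u hu v hv => ?_
  have ne_of_mem {w : W} (hw : w ∈ S) : x ≠ w := fun h => hx (h ▸ hw)
  simpa [compl_adj, ne_of_mem hu, ne_of_mem hv, not_iff_not] using hS x hx u hu v hv

lemma isPrime_pathGraph_five : IsPrime (pathGraph 5) := by
  have decided : ∀ s : Finset (Fin 5),
      (∀ x ∉ s, ∀ u ∈ s, ∀ v ∈ s, ((pathGraph 5).Adj x u ↔ (pathGraph 5).Adj x v)) →
      (∀ u ∈ s, ∀ v ∈ s, u = v) ∨ ∀ x, x ∈ s := by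
    decide
  classical
  intro S hS
  obtain h | h := decided S.toFinset (by simpa [IsHomogeneous] using hS)
  · exact .inl fun u hu v hv => h u (by simpa) v (by simpa)
  · exact .inr (Set.eq_univ_of_forall (by simpa using h))

namespace IsSubstitution

lemma isIndContained_or (hG : IsSubstitution G Q π) (hH : IsPrime H) (h : H ⊴ G) :
    H ⊴ Q ∨ ∃ i, H ⊴ G.induce (π ⁻¹' {i}) := by
  obtain ⟨f⟩ := h
  have adj_iff {a b : W} (hab : π (f a) ≠ π (f b)) : H.Adj a b ↔ Q.Adj (π (f a)) (π (f b)) :=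
    f.map_rel_iff.symm.trans (hG _ _ hab)
  by_cases hinj : Function.Injective fun a => π (f a)
  · refine .inl ⟨⟨⟨_, hinj⟩, fun {a b} => ?_⟩⟩
    rcases eq_or_ne a b with rfl | hab
    · simp
    · exact (adj_iff (hinj.ne hab)).symm
  · simp only [Function.Injective, not_forall] at hinj
    obtain ⟨a, b, hab, hne⟩ := hinj
    have hhom : IsHomogeneous H {c | π (f c) = π (f a)} := by
      intro x (hx : π (f x) ≠ π (f a)) u (hu : π (f u) = π (f a)) v (hv : π (f v) = π (f a))
      rw [adj_iff (hu ▸ hx), adj_iff (hv ▸ hx), hu, hv]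
    obtain h | h := hH _ hhom
    · exact absurd (h rfl hab.symm) hne
    · exact .inr ⟨π (f a), ⟨⟨⟨fun c => ⟨f c, h.ge (Set.mem_univ c)⟩,
        fun _ _ h => f.injective (congrArg Subtype.val h)⟩, f.map_rel_iff⟩⟩⟩

lemma isP5HouseFree (hG : IsSubstitution G Q π) (hQ : IsP5HouseFree Q)
    (h : ∀ i, IsP5HouseFree (G.induce (π ⁻¹' {i}))) : IsP5HouseFree G where
  path hP := (hG.isIndContained_or isPrime_pathGraph_five hP).elim hQ.path
    fun ⟨i, hi⟩ => (h i).path hi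
  house hP := (hG.isIndContained_or isPrime_pathGraph_five.compl hP).elim hQ.house
    fun ⟨i, hi⟩ => (h i).house hi

lemma nonempty_iso (hG : IsSubstitution G Q π) (hH : IsSubstitution H Q ρ)
    (h : ∀ i, Nonempty (G.induce (π ⁻¹' {i}) ≃g H.induce (ρ ⁻¹' {i}))) : Nonempty (G ≃g H) := by
  let e (i : ι) := (h i).some
  let f : V ≃ W := (Equiv.sigmaFiberEquiv π).symm.trans
    ((Equiv.sigmaCongrRight fun i => (e i).toEquiv).trans (Equiv.sigmaFiberEquiv ρ))
  have f_eq {v : V} {i : ι} (hv : π v = i) : f v = e i ⟨v, hv⟩ := by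
    subst hv
    rfl
  have π_f (v : V) : ρ (f v) = π v := by
    rw [f_eq rfl]
    exact (e (π v) ⟨v, rfl⟩).2
  refine ⟨⟨f, fun {u v} => ?_⟩⟩
  by_cases huv : π u = π v
  · rw [f_eq huv, f_eq rfl]
    exact (e (π v)).map_rel_iff
  · rw [hG u v huv, hH _ _ (by rwa [π_f, π_f]), π_f, π_f]

end IsSubstitution

lemma isP5HouseFree_top : IsP5HouseFree (⊤ : SimpleGraph V) where
  path h := absurd (congrArg (Adj · 0 2) (eq_top_of_isIndContained_top h)) (by decide)
  house h := absurd (congrArg (Adj · 0 1) (eq_top_of_isIndContained_top h)) (by decide)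

lemma isP5HouseFree_cycleGraph_five : IsP5HouseFree (cycleGraph 5) := by
  have card_edges {H : SimpleGraph (Fin 5)} [DecidableRel H.Adj] (h : H ⊴ cycleGraph 5) :
      H.edgeFinset.card = 5 := by
    obtain ⟨f⟩ := h
    let e : H ≃g cycleGraph 5 :=
      ⟨.ofBijective f (Finite.injective_iff_bijective.1 f.injective), f.map_rel_iff⟩
    rw [e.card_edgeFinset_eq]
    decide
  exact ⟨fun h => absurd (card_edges h) (by decide), fun h => absurd (card_edges h) (by decide)⟩

end InducedCopies

section CritFamily

variable {G H : FinGraph} {k : ℕ}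

lemma cls_eq_iff : G.cls = H.cls ↔ Nonempty (G.graph ≃g H.graph) :=
  Quotient.eq (r := isoSetoid)

lemma isCritical_iff : G.IsCritical k ↔ IsCriticalOn G.graph Set.univ k := by
  have := G.finite
  have chromaticNumber_univ : (G.graph.induce Set.univ).chromaticNumber = G.graph.chromaticNumber :=
    chromaticNumber_congr (induceUnivIso G.graph)
  constructor
  · rintro ⟨hk, hS⟩
    refine ⟨@(le_chromaticNumber_iff_colorable.1 (chromaticNumber_univ.trans hk).ge),
      fun {v} _ => ?_⟩
    have hle : (G.graph.induce (Set.univ \ {v})).chromaticNumber ≤ k :=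
      hk ▸ chromaticNumber_mono_of_hom (Embedding.induce _).toHom
    have hlt := hle.lt_of_ne (hS _ fun h => (h.ge (Set.mem_univ v)).2 rfl)
    obtain ⟨n, hn⟩ := ENat.ne_top_iff_exists.1 hlt.ne_top
    rw [← hn, Nat.cast_lt] at hlt
    exact ⟨k - 1, by omega, (chromaticNumber_le_iff_colorable.1 hn.ge).mono (by omega)⟩
  · refine fun h => ⟨?_, fun S hS hk => ?_⟩
    · rw [← chromaticNumber_univ]
      exact le_antisymm (chromaticNumber_le_iff_colorable.2 (h.colorable_iff.2 le_rfl))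
        (le_chromaticNumber_iff_colorable.2 fun n => h.le_of_colorable)
    · obtain ⟨v, hv⟩ := (Set.ne_univ_iff_exists_notMem S).1 hS
      obtain ⟨n, rfl, hn⟩ := h.exists_colorable_diff (Set.mem_univ v)
      have hSv : S ⊆ Set.univ \ {v} := fun u hu => ⟨trivial, fun e => hv (e ▸ hu)⟩
      have := le_chromaticNumber_iff_colorable.1 hk.ge n (colorable_induce_mono hSv hn)
      omega

lemma IsP5CoP5Free.isP5HouseFree (h : G.IsP5CoP5Free) : IsP5HouseFree G.graph :=
  ⟨h.1, h.2⟩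

lemma cls_mem_critFamily_iff :
    G.cls ∈ critFamily k ↔ IsCriticalOn G.graph Set.univ k ∧ IsP5HouseFree G.graph := by
  rw [← isCritical_iff]
  constructor
  · rintro ⟨H, ⟨hH, hfree⟩, hHG⟩
    obtain ⟨e⟩ := cls_eq_iff.1 hHG
    rw [isCritical_iff, ← Set.image_univ_of_surjective e.surjective]
    exact ⟨(isCriticalOn_image_iff e.toEmbedding).2 (isCritical_iff.1 hH),
      hfree.isP5HouseFree.of_isIndContained e.isIndContained'⟩
  · exact fun ⟨hG, hfree⟩ => ⟨G, ⟨hG, hfree.path, hfree.house⟩, rfl⟩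

/-- The subgraph induced by a set of vertices, as a finite graph. -/
def sub (G : FinGraph) (S : Set G.V) : FinGraph :=
  ⟨S, have := G.finite; inferInstance, G.graph.induce S⟩

lemma cls_sub_mem_critFamily_iff {S : Set G.V} : (G.sub S).cls ∈ critFamily k ↔
    IsCriticalOn G.graph S k ∧ IsP5HouseFree (G.graph.induce S) :=
  cls_mem_critFamily_iff.trans (and_congr_left' isCriticalOn_induce_univ_iff)

lemma cls_sub_of_range_eq {S : Set G.V} (f : H.graph ↪g G.graph) (hf : Set.range f = S) :
    (G.sub S).cls = H.cls := by
  subst hf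
  exact cls_eq_iff.2 ⟨f.isoInduceRange.symm⟩

end CritFamily

section JoinBuoy

variable {G G' H H' : FinGraph} {B B' : Fin 5 → FinGraph} {ι : Type*} {Q : SimpleGraph ι}
  {π : G.V → ι} {ρ : H.V → ι} {k l m : ℕ} {p : Fin 5 → ℕ}

lemma cls_eq_of_isSubstitution (hG : IsSubstitution G.graph Q π) (hH : IsSubstitution H.graph Q ρ)
    (h : ∀ i, (G.sub (π ⁻¹' {i})).cls = (H.sub (ρ ⁻¹' {i})).cls) : G.cls = H.cls :=
  cls_eq_iff.2 (hG.nonempty_iso hH fun i => cls_eq_iff.1 (h i))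

theorem cls_mem_critFamily_iff_of_isSubstitution [DecidableEq ι] {k : ι → ℕ}
    (h : IsSubstitution G.graph Q π) (hQ : IsP5HouseFree Q) (hpos : ∀ i, 0 < k i)
    (hk : ∀ i, (G.sub (π ⁻¹' {i})).cls ∈ critFamily (k i)) :
    G.cls ∈ critFamily m ↔ IsCriticalWeight Q k m := by
  simp only [cls_sub_mem_critFamily_iff] at hk
  have hπ : π.Surjective := fun i => (hk i).1.nonempty (hpos i)
  rw [cls_mem_critFamily_iff, h.isCriticalOn_univ_iff hπ fun i => (hk i).1,
    and_iff_left (h.isP5HouseFree hQ fun i => (hk i).2)]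

theorem exists_isCriticalWeight_of_isSubstitution [DecidableEq ι]
    (hG : G.cls ∈ critFamily m) (h : IsSubstitution G.graph Q π) (hπ : π.Surjective) :
    ∃ k : ι → ℕ, (∀ i, 0 < k i) ∧ (∀ i, (G.sub (π ⁻¹' {i})).cls ∈ critFamily (k i)) ∧
      IsCriticalWeight Q k m := by
  obtain ⟨hcrit, hfree⟩ := cls_mem_critFamily_iff.1 hG
  obtain ⟨k, hk⟩ := h.exists_isCriticalOn_fibers hcrit
  exact ⟨k, fun i => (hk i).pos (hπ i),
    fun i => cls_sub_mem_critFamily_iff.2 ⟨hk i, hfree.of_isIndContained ⟨Embedding.induce _⟩⟩,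
    (h.isCriticalOn_univ_iff hπ hk).1 hcrit⟩

lemma isSubstitution_join (G H : FinGraph) : IsSubstitution (join G H).graph ⊤ Sum.isRight := by
  rintro (u | u) (v | v) huv <;> simp [join] at huv ⊢

lemma cls_sub_join (G H : FinGraph) (b : Bool) :
    ((join G H).sub (Sum.isRight ⁻¹' {b})).cls = (bif b then H else G).cls := by
  cases b
  · let f : G.graph ↪g (G.graph ⊕g H.graph) ⊔ completeBipartiteGraph _ _ := ⟨.inl, by simp⟩
    have range_f : Set.range f = Sum.isRight ⁻¹' {false} := by ext (x | x) <;> simp [f]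
    exact cls_sub_of_range_eq (G := join G H) f range_f
  · let f : H.graph ↪g (G.graph ⊕g H.graph) ⊔ completeBipartiteGraph _ _ := ⟨.inr, by simp⟩
    have range_f : Set.range f = Sum.isRight ⁻¹' {true} := by ext (x | x) <;> simp [f]
    exact cls_sub_of_range_eq (G := join G H) f range_f

lemma cls_eq_join {π : G.V → Bool} (h : IsSubstitution G.graph ⊤ π) :
    G.cls = (join (G.sub (π ⁻¹' {false})) (G.sub (π ⁻¹' {true}))).cls :=
  cls_eq_of_isSubstitution h (isSubstitution_join _ _) fun b => by
    rw [cls_sub_join]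
    cases b <;> rfl

lemma cls_join_congr (hG : G.cls = G'.cls) (hH : H.cls = H'.cls) :
    (join G H).cls = (join G' H').cls :=
  cls_eq_of_isSubstitution (isSubstitution_join _ _) (isSubstitution_join _ _) fun b => by
    rw [cls_sub_join, cls_sub_join]
    cases b <;> assumption

lemma cls_join_comm (G H : FinGraph) : (join G H).cls = (join H G).cls := by
  have e : (G.graph ⊕g H.graph) ⊔ completeBipartiteGraph G.V H.V ≃g
      (H.graph ⊕g G.graph) ⊔ completeBipartiteGraph H.V G.V :=
    ⟨Equiv.sumComm _ _, by rintro (x | x) (y | y) <;> simp⟩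
  exact cls_eq_iff.2 ⟨e⟩

lemma cls_join_assoc (G H J : FinGraph) :
    (join (join G H) J).cls = (join G (join H J)).cls := by
  have e : (((G.graph ⊕g H.graph) ⊔ completeBipartiteGraph _ _) ⊕g J.graph) ⊔
      completeBipartiteGraph _ _ ≃g
      (G.graph ⊕g ((H.graph ⊕g J.graph) ⊔ completeBipartiteGraph _ _)) ⊔
      completeBipartiteGraph _ _ :=
    ⟨Equiv.sumAssoc _ _ _, by rintro ((x | x) | x) ((y | y) | y) <;> simp⟩
  exact cls_eq_iff.2 ⟨e⟩

lemma isSubstitution_buoy (B : Fin 5 → FinGraph) :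
    IsSubstitution (buoy B).graph (cycleGraph 5) Sigma.fst := by
  refine fun u v huv => or_iff_left ?_
  rintro ⟨i, x, y, rfl, rfl, -⟩
  exact huv rfl

lemma buoy_adj_mk {i : Fin 5} {x y : (B i).V} :
    (buoy B).graph.Adj ⟨i, x⟩ ⟨i, y⟩ ↔ (B i).graph.Adj x y := by
  refine ⟨?_, fun h => .inr ⟨i, x, y, rfl, rfl, h⟩⟩
  rintro (h | ⟨j, a, b, ha, hb, h⟩)
  · exact absurd h (SimpleGraph.irrefl _)
  · cases ha
    cases hb
    exact h

lemma cls_sub_buoy (B : Fin 5 → FinGraph) (i : Fin 5) :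
    ((buoy B).sub (Sigma.fst ⁻¹' {i})).cls = (B i).cls := by
  let f : (B i).graph ↪g (buoy B).graph :=
    ⟨Function.Embedding.sigmaMk (β := fun i => (B i).V) i, buoy_adj_mk⟩
  have range_f : Set.range f = Sigma.fst ⁻¹' {i} :=
    Set.range_sigmaMk (α := fun i => (B i).V) i
  exact cls_sub_of_range_eq f range_f

lemma cls_eq_buoy {π : G.V → Fin 5} (h : IsSubstitution G.graph (cycleGraph 5) π) :
    G.cls = (buoy fun i => G.sub (π ⁻¹' {i})).cls :=
  cls_eq_of_isSubstitution h (isSubstitution_buoy _) fun i =>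
    (cls_sub_buoy (fun i => G.sub (π ⁻¹' {i})) i).symm

lemma cls_buoy_congr (h : ∀ i, (B i).cls = (B' i).cls) : (buoy B).cls = (buoy B').cls :=
  cls_eq_of_isSubstitution (isSubstitution_buoy _) (isSubstitution_buoy _) fun i => by
    rw [cls_sub_buoy, cls_sub_buoy, h]

lemma cls_buoy_comp_iso (B : Fin 5 → FinGraph) (σ : cycleGraph 5 ≃g cycleGraph 5) :
    (buoy (B ∘ σ)).cls = (buoy B).cls := by
  have h : IsSubstitution (buoy B).graph (cycleGraph 5) fun x => σ.symm x.1 := fun u v huv =>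
    (isSubstitution_buoy B u v fun e => huv (congrArg σ.symm e)).trans σ.symm.map_rel_iff.symm
  refine cls_eq_of_isSubstitution (isSubstitution_buoy _) h fun i => ?_
  have fiber_eq : (fun x : (buoy B).V => σ.symm x.1) ⁻¹' {i} = Sigma.fst ⁻¹' {σ i} :=
    Set.ext fun x => σ.toEquiv.symm_apply_eq
  exact (cls_sub_buoy (B ∘ σ) i).trans
    ((congrArg (fun S => ((buoy B).sub S).cls) fiber_eq).trans (cls_sub_buoy B (σ i))).symm

theorem cls_join_mem_critFamily (hk : 0 < k) (hl : 0 < l) (hG : G.cls ∈ critFamily k)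
    (hH : H.cls ∈ critFamily l) : (join G H).cls ∈ critFamily (k + l) := by
  have hpos : ∀ b : Bool, 0 < bif b then l else k := by simp [hk, hl]
  refine (cls_mem_critFamily_iff_of_isSubstitution (isSubstitution_join G H) isP5HouseFree_top
    hpos fun b => ?_).2 ((isCriticalWeight_top_iff hpos).2 (by simp [add_comm]))
  rw [cls_sub_join]
  cases b <;> assumption

theorem cls_buoy_mem_critFamily (hp : IsPattern m p) (hB : ∀ i, (B i).cls ∈ critFamily (p i)) :
    (buoy B).cls ∈ critFamily m :=
  (cls_mem_critFamily_iff_of_isSubstitution (isSubstitution_buoy B) isP5HouseFree_cycleGraph_five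
    hp.1 fun i => (cls_sub_buoy B i).symm ▸ hB i).2
    ((isCriticalWeight_cycleGraph_five_iff hp.1).2 hp)

theorem critFamily_eq (hm : 2 ≤ m) : critFamily m = joinFamily m ∪ buoyFamily m := by
  ext c
  constructor
  · induction c using Quotient.inductionOn with | _ G =>
    intro (hG : G.cls ∈ critFamily m)
    have := G.finite
    obtain ⟨hcrit, hfree⟩ := cls_mem_critFamily_iff.1 hG
    obtain ⟨π, hπ, h⟩ | ⟨π, hπ, h⟩ := hcrit.exists_isSubstitution hm hfree <;>
      obtain ⟨k, hpos, hk, hweight⟩ := exists_isCriticalWeight_of_isSubstitution hG h hπ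
    · have hsum := (isCriticalWeight_top_iff hpos).1 hweight
      rw [Fintype.sum_bool, add_comm] at hsum
      exact .inl ⟨_, _, hpos _, hpos _, hsum, _, _, hk _, hk _, cls_eq_join h⟩
    · exact .inr ⟨k, (isCriticalWeight_cycleGraph_five_iff hpos).1 hweight, _, hk, cls_eq_buoy h⟩
  · rintro (⟨k, l, hk, hl, rfl, G, H, hG, hH, rfl⟩ | ⟨p, hp, B, hB, rfl⟩)
    · exact cls_join_mem_critFamily hk hl hG hH
    · exact cls_buoy_mem_critFamily hp hB

end JoinBuoy

/-! ### Admissible patterns -/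

section Patterns

variable {k : ℕ} {p q : Fin 5 → ℕ} {L : List (Fin 5 → ℕ)}

lemma CircEquiv.exists_iso (h : CircEquiv p q) :
    ∃ σ : cycleGraph 5 ≃g cycleGraph 5, p = q ∘ σ := by
  obtain ⟨c, h | h⟩ := h
  · exact ⟨⟨Equiv.addLeft c, by clear h; decide +revert⟩, funext h⟩
  · exact ⟨⟨Equiv.subLeft c, by clear h; decide +revert⟩, funext h⟩

lemma IsPattern.comp_iso (hp : IsPattern k p) (σ : cycleGraph 5 ≃g cycleGraph 5) :
    IsPattern k (p ∘ σ) := by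
  obtain ⟨hpos, hle, hsum⟩ := hp
  refine ⟨fun i => hpos _, fun i => ?_, (congrArg (· + 1) (σ.toEquiv.sum_comp p)).trans hsum⟩
  have hadj : (cycleGraph 5).Adj (σ i) (σ (i + 1)) :=
    σ.map_rel_iff.2 (cycleGraph_five_adj.2 (.inl rfl))
  obtain h | h := cycleGraph_five_adj.1 hadj
  · simpa only [Function.comp_apply, h] using hle (σ i)
  · simpa only [Function.comp_apply, h, add_comm] using hle (σ (i + 1))

lemma buoysOfPattern_subset_comp_iso (p : Fin 5 → ℕ) (σ : cycleGraph 5 ≃g cycleGraph 5) :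
    buoysOfPattern p ⊆ buoysOfPattern (p ∘ σ) := by
  rintro _ ⟨B, hB, rfl⟩
  exact ⟨B ∘ σ, fun i => hB (σ i), (cls_buoy_comp_iso B σ).symm⟩

lemma buoysOfPattern_comp_iso (p : Fin 5 → ℕ) (σ : cycleGraph 5 ≃g cycleGraph 5) :
    buoysOfPattern (p ∘ σ) = buoysOfPattern p := by
  refine Set.Subset.antisymm ?_ (buoysOfPattern_subset_comp_iso p σ)
  have comp_symm : (p ∘ σ) ∘ σ.symm = p := funext fun i => congrArg p (σ.apply_symm_apply i)
  exact (buoysOfPattern_subset_comp_iso (p ∘ σ) σ.symm).trans_eq (congrArg _ comp_symm)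

lemma PatternsAre.buoyFamily_eq (h : PatternsAre k L) :
    buoyFamily k = {c | ∃ q ∈ L, c ∈ buoysOfPattern q} := by
  ext c
  constructor
  · rintro ⟨p, hp, hc⟩
    obtain ⟨q, hq, hpq⟩ := (h.1 p).1 hp
    obtain ⟨σ, rfl⟩ := hpq.exists_iso
    exact ⟨q, hq, buoysOfPattern_comp_iso q σ ▸ hc⟩
  · rintro ⟨q, hq, hc⟩
    exact ⟨q, (h.1 q).2 ⟨q, hq, 0, .inl fun i => congrArg q (zero_add i).symm⟩, hc⟩

lemma PatternsAre.buoyFamily_eq_buoysOfPattern (h : PatternsAre k [p]) :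
    buoyFamily k = buoysOfPattern p := by
  simp [h.buoyFamily_eq]

lemma buoyFamily_eq_empty (hk : k ≤ 2) : buoyFamily k = ∅ := by
  refine Set.eq_empty_of_forall_notMem fun c ⟨p, ⟨hpos, _, hsum⟩, _⟩ => ?_
  have five_le : 5 ≤ ∑ i, p i := by
    simpa using Finset.card_nsmul_le_sum Finset.univ p 1 fun i _ => hpos i
  omega

instance : DecidableRel CircEquiv := fun p q =>
  inferInstanceAs (Decidable (∃ c : Fin 5, (∀ i, p i = q (c + i)) ∨ (∀ i, p i = q (c - i))))

instance (k : ℕ) : DecidablePred (IsPattern k) := fun p =>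
  inferInstanceAs (Decidable
    ((∀ i, 0 < p i) ∧ (∀ i, p i + p (i + 1) + 1 ≤ k) ∧ ∑ i, p i + 1 = 2 * k))

lemma patternsAre_of_forall_fin (hL : ∀ q ∈ L, IsPattern k q)
    (exists_circEquiv : ∀ a b c d : Fin k,
      let p : Fin 5 → ℕ := ![a, b, c, d, 2 * k - 1 - (a + b + c + d)]
      IsPattern k p → ∃ q ∈ L, CircEquiv p q)
    (hpairwise : L.Pairwise fun p q => ¬ CircEquiv p q) : PatternsAre k L := by
  refine ⟨fun p => ⟨fun hp => ?_, ?_⟩, hpairwise⟩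
  · have lt (i : Fin 5) : p i < k := by
      have := hp.2.1 i
      omega
    have last_eq : p 4 = 2 * k - 1 - (p 0 + p 1 + p 2 + p 3) := by
      have := hp.2.2
      rw [Fin.sum_univ_five] at this
      omega
    have eta : p = ![p 0, p 1, p 2, p 3, 2 * k - 1 - (p 0 + p 1 + p 2 + p 3)] :=
      last_eq ▸ List.ofFn_injective rfl
    rw [eta] at hp ⊢
    exact exists_circEquiv ⟨_, lt 0⟩ ⟨_, lt 1⟩ ⟨_, lt 2⟩ ⟨_, lt 3⟩ hp
  · rintro ⟨q, hq, h⟩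
    obtain ⟨σ, rfl⟩ := h.exists_iso
    exact (hL q hq).comp_iso σ

lemma patternsAre_three : PatternsAre 3 [![1, 1, 1, 1, 1]] :=
  patternsAre_of_forall_fin (by decide) (by decide +kernel) (by decide)

lemma patternsAre_four : PatternsAre 4 [![1, 2, 1, 2, 1]] :=
  patternsAre_of_forall_fin (by decide) (by decide +kernel) (by decide)

lemma patternsAre_five :
    PatternsAre 5 [![2, 2, 2, 2, 1], ![2, 1, 3, 1, 2], ![1, 3, 1, 3, 1]] :=
  patternsAre_of_forall_fin (by decide) (by decide +kernel) (by decide)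

lemma patternsAre_six : PatternsAre 6 [![2, 2, 2, 2, 3], ![2, 3, 2, 3, 1], ![2, 3, 1, 3, 2],
    ![1, 4, 1, 3, 2], ![1, 4, 1, 4, 1]] :=
  patternsAre_of_forall_fin (by decide) (by decide +kernel) (by decide)

lemma buoyFamily_five_eq_union : buoyFamily 5 = buoysOfPattern ![2, 2, 2, 2, 1] ∪
    buoysOfPattern ![2, 1, 3, 1, 2] ∪ buoysOfPattern ![1, 3, 1, 3, 1] := by
  ext c
  simp [patternsAre_five.buoyFamily_eq, or_assoc]

lemma buoyFamily_six_eq_union : buoyFamily 6 =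
    buoysOfPattern ![2, 2, 2, 2, 3] ∪ buoysOfPattern ![2, 3, 2, 3, 1] ∪
      buoysOfPattern ![2, 3, 1, 3, 2] ∪ buoysOfPattern ![1, 4, 1, 3, 2] ∪
      buoysOfPattern ![1, 4, 1, 4, 1] := by
  ext c
  simp [patternsAre_six.buoyFamily_eq, or_assoc]

end Patterns

/-! ### Degree multisets -/

section DegreeMultiset

variable {G H : FinGraph}

/-- The multiset of vertex degrees, the invariant used to tell critical graphs apart. It is
written as a finitary sum of singletons to avoid choosing an enumeration of the vertices. -/
noncomputable def degrees (G : FinGraph) : Multiset ℕ :=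
  ∑ᶠ v, {(G.graph.neighborSet v).ncard}

lemma degrees_eq_of_cls_eq (h : G.cls = H.cls) : G.degrees = H.degrees := by
  obtain ⟨e⟩ := cls_eq_iff.1 h
  have ncard_eq (v : G.V) :
      (H.graph.neighborSet (e v)).ncard = (G.graph.neighborSet v).ncard :=
    (Nat.card_congr (e.mapNeighborSet v)).symm
  simp only [degrees, ← finsum_comp_equiv e.toEquiv]
  exact finsum_congr fun v => congrArg _ (ncard_eq v).symm

lemma card_degrees (G : FinGraph) : G.degrees.card = Nat.card G.V := by
  have := G.finite
  have := Fintype.ofFinite G.V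
  simp [degrees, finsum_eq_sum_of_fintype]

lemma degrees_eq_replicate {d : ℕ} (h : ∀ v, (G.graph.neighborSet v).ncard = d) :
    G.degrees = Multiset.replicate (Nat.card G.V) d := by
  refine card_degrees G ▸ Multiset.eq_replicate_card.2 fun b hb => ?_
  have := G.finite
  have := Fintype.ofFinite G.V
  rw [degrees, finsum_eq_sum_of_fintype, Multiset.mem_sum] at hb
  obtain ⟨v, -, hv⟩ := hb
  exact (Multiset.mem_singleton.1 hv).trans (h v)

lemma degrees_K (n : ℕ) : (K n).degrees = Multiset.replicate n (n - 1) := by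
  have ncard_neighborSet (v : Fin n) :
      ((⊤ : SimpleGraph (Fin n)).neighborSet v).ncard = n - 1 := by
    rw [neighborSet_top, Set.ncard_compl, Set.ncard_singleton, Nat.card_fin]
  rw [degrees_eq_replicate (G := K n) ncard_neighborSet]
  exact congrArg (Multiset.replicate · _) (Nat.card_fin n)

lemma degrees_C5 : C5.degrees = Multiset.replicate 5 2 := by
  have ncard_neighborSet (v : Fin 5) : ((cycleGraph 5).neighborSet v).ncard = 2 := by
    rw [Set.ncard_eq_toFinset_card']
    exact cycleGraph_degree_three_le
  rw [degrees_eq_replicate (G := C5) ncard_neighborSet]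
  exact congrArg (Multiset.replicate · _) (Nat.card_fin 5)

end DegreeMultiset

namespace IsSubstitution

variable {G : FinGraph} {ι : Type*} {Q : SimpleGraph ι} [DecidableRel Q.Adj] {π : G.V → ι}

lemma ncard_neighborSet_inter_fiber [DecidableEq ι] (h : IsSubstitution G.graph Q π) {i : ι}
    (v : π ⁻¹' {i}) (j : ι) : (G.graph.neighborSet v ∩ π ⁻¹' {j}).ncard =
      (if j = i then ((G.graph.induce (π ⁻¹' {i})).neighborSet v).ncard else 0) +
        if Q.Adj i j then Nat.card (π ⁻¹' {j}) else 0 := by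
  rcases eq_or_ne j i with rfl | hne
  · have inter_eq : G.graph.neighborSet v ∩ π ⁻¹' {j} =
        Subtype.val '' (G.graph.induce (π ⁻¹' {j})).neighborSet v :=
      (Set.inter_comm _ _).trans (Subtype.image_preimage_coe _ _).symm
    rw [inter_eq, Set.ncard_image_of_injective _ Subtype.val_injective]
    simp
  · have adj_iff {w : G.V} (hw : π w = j) : G.graph.Adj v w ↔ Q.Adj i j := by
      have hv : π v = i := v.2
      rw [h v w (by rwa [hv, hw, ne_comm]), hv, hw]
    by_cases hij : Q.Adj i j
    · have inter_eq : G.graph.neighborSet v ∩ π ⁻¹' {j} = π ⁻¹' {j} :=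
        Set.inter_eq_right.2 fun w hw => (adj_iff hw).2 hij
      simp [hne, hij, inter_eq, Set.ncard]
    · have inter_eq : G.graph.neighborSet v ∩ π ⁻¹' {j} = ∅ :=
        Set.eq_empty_iff_forall_notMem.2 fun w ⟨hvw, hw⟩ => hij ((adj_iff hw).1 hvw)
      simp [hne, hij, inter_eq]

open Function in
lemma ncard_neighborSet [Fintype ι] (h : IsSubstitution G.graph Q π) {i : ι} (v : π ⁻¹' {i}) :
    (G.graph.neighborSet v).ncard = ((G.graph.induce (π ⁻¹' {i})).neighborSet v).ncard +
      ∑ j with Q.Adj i j, Nat.card (π ⁻¹' {j}) := by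
  classical
  have := G.finite
  let N (j : ι) : Set G.V := G.graph.neighborSet v ∩ π ⁻¹' {j}
  have iUnion_N : ⋃ j, N j = G.graph.neighborSet v := by
    rw [← Set.inter_iUnion, ← Set.preimage_iUnion, Set.iUnion_of_singleton, Set.preimage_univ,
      Set.inter_univ]
  have disjoint_N : Pairwise (Disjoint on N) := fun j l hjl =>
    (Set.disjoint_singleton.2 hjl).preimage π |>.mono Set.inter_subset_right Set.inter_subset_right
  rw [← iUnion_N, Set.ncard_iUnion_of_finite (fun j => Set.toFinite _) disjoint_N,
    finsum_eq_sum_of_fintype, Finset.sum_congr rfl fun j _ => h.ncard_neighborSet_inter_fiber v j,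
    Finset.sum_add_distrib, Finset.sum_ite_eq', if_pos (Finset.mem_univ i), Finset.sum_filter]

theorem degrees_eq [Fintype ι] (h : IsSubstitution G.graph Q π) :
    G.degrees = ∑ i, (G.sub (π ⁻¹' {i})).degrees.map
      (· + ∑ j with Q.Adj i j, (G.sub (π ⁻¹' {j})).degrees.card) := by
  classical
  have := G.finite
  have := Fintype.ofFinite G.V
  calc G.degrees = ∑ i, ∑ᶠ v : π ⁻¹' {i}, {(G.graph.neighborSet v).ncard} := by
        simp only [degrees, finsum_eq_sum_of_fintype]
        exact (Fintype.sum_fiberwise π _).symm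
    _ = _ := by
        refine Finset.sum_congr rfl fun i _ => ?_
        have := (G.sub (π ⁻¹' {i})).finite
        rw [← Multiset.coe_mapAddMonoidHom, degrees,
          AddMonoidHom.map_finsum _ (Set.toFinite _)]
        refine finsum_congr fun v => ?_
        simpa [card_degrees, sub] using h.ncard_neighborSet v

end IsSubstitution

section JoinBuoyDegrees

variable (G H : FinGraph) (B : Fin 5 → FinGraph)

lemma degrees_join : (join G H).degrees =
    G.degrees.map (· + H.degrees.card) + H.degrees.map (· + G.degrees.card) := by
  have degrees_sub (b : Bool) :
      ((join G H).sub (Sum.isRight ⁻¹' {b})).degrees = (bif b then H else G).degrees :=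
    degrees_eq_of_cls_eq (cls_sub_join G H b)
  rw [(isSubstitution_join G H).degrees_eq, Fintype.sum_bool, add_comm]
  simp [degrees_sub, Finset.sum_filter]

lemma degrees_buoy : (buoy B).degrees = ∑ i, (B i).degrees.map
    (· + ((B (i + 1)).degrees.card + (B (i - 1)).degrees.card)) := by
  have degrees_sub (i : Fin 5) :
      ((buoy B).sub (Sigma.fst ⁻¹' {i})).degrees = (B i).degrees :=
    degrees_eq_of_cls_eq (cls_sub_buoy B i)
  have neighbors_eq (i : Fin 5) :
      Finset.univ.filter ((cycleGraph 5).Adj i) = {i + 1, i - 1} := by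
    revert i
    decide
  have ne (i : Fin 5) : i + 1 ≠ i - 1 := by
    revert i
    decide
  simp only [(isSubstitution_buoy B).degrees_eq, degrees_sub, neighbors_eq, Finset.sum_pair (ne _)]

end JoinBuoyDegrees

/-! ### Small critical graphs -/

section ConcreteGraphs

variable {G : FinGraph} {n : ℕ}

lemma cls_eq_cls_K (hG : ∀ u v, u ≠ v → G.graph.Adj u v) (hn : Nat.card G.V = n) :
    G.cls = (K n).cls := by
  have := G.finite
  let e : G.V ≃ Fin n := Finite.equivFinOfCardEq hn
  have e' : G.graph ≃g (⊤ : SimpleGraph (Fin n)) :=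
    ⟨e, fun {u v} => ⟨fun h => hG u v fun he => h.ne (congrArg e he), fun h => e.injective.ne h.ne⟩⟩
  exact cls_eq_iff.2 ⟨e'⟩

lemma cls_join_K (m n : ℕ) : (join (K m) (K n)).cls = (K (m + n)).cls := by
  have adj (u v : Fin m ⊕ Fin n) (huv : u ≠ v) :
      ((⊤ ⊕g ⊤) ⊔ completeBipartiteGraph (Fin m) (Fin n)).Adj u v := by
    rcases u with u | u <;> rcases v with v | v <;> simp_all
  have card_sum : Nat.card (Fin m ⊕ Fin n) = m + n := by simp
  exact cls_eq_cls_K (G := join (K m) (K n)) adj card_sum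

lemma cls_eq_buoy_K {π : G.V → Fin 5} {n : Fin 5 → ℕ}
    (hadj : ∀ u v, G.graph.Adj u v ↔ u ≠ v ∧ (π u = π v ∨ (cycleGraph 5).Adj (π u) (π v)))
    (hn : ∀ i, Nat.card (π ⁻¹' {i}) = n i) : G.cls = (buoy fun i => K (n i)).cls := by
  have h : IsSubstitution G.graph (cycleGraph 5) π := fun u v huv =>
    (hadj u v).trans ⟨fun h => h.2.resolve_left huv, fun h => ⟨fun e => huv (e ▸ rfl), .inr h⟩⟩
  have cls_sub (i : Fin 5) : (G.sub (π ⁻¹' {i})).cls = (K (n i)).cls :=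
    cls_eq_cls_K (fun u v huv => (hadj u.1 v.1).2
      ⟨fun e => huv (Subtype.ext e), .inl (Eq.trans u.2 v.2.symm)⟩) (hn i)
  exact (cls_eq_buoy h).trans (cls_buoy_congr cls_sub)

lemma cls_C5 : C5.cls = (buoy fun _ => K 1).cls :=
  cls_eq_buoy_K (G := C5) (π := id) (n := fun _ => 1)
    (fun _ _ => ⟨fun h => ⟨h.ne, .inr h⟩, fun h => h.2.resolve_left h.1⟩)
    fun i => Nat.card_unique (α := ({i} : Set (Fin 5)))

lemma cls_T2 : T2.cls = (join (K 1) C5).cls := by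
  let f : Fin 1 ⊕ Fin 5 → Fin 6 := Sum.elim (fun _ => 5) Fin.castSucc
  have adj_iff (u v : Fin 1 ⊕ Fin 5) : T2.graph.Adj (f u) (f v) ↔
      ((⊤ ⊕g cycleGraph 5) ⊔ completeBipartiteGraph (Fin 1) (Fin 5)).Adj u v := by
    simp only [T2, fromEdgeSet_adj, Set.mem_insert_iff, Set.mem_singleton_iff]
    rcases u with u | u <;> rcases v with v | v <;>
      simp only [sup_adj, sum_adj, completeBipartiteGraph_adj] <;> decide +revert
  have bijective_f : f.Bijective := by decide
  exact (cls_eq_iff.2 ⟨.ofBijective f bijective_f, adj_iff _ _⟩).symm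

lemma cls_T3 : T3.cls = (buoy ![K 1, K 2, K 1, K 2, K 1]).cls := by
  let π : Fin 7 → Fin 5 := ![1, 2, 3, 4, 0, 1, 3]
  have adj_iff (u v : Fin 7) : T3.graph.Adj u v ↔
      u ≠ v ∧ (π u = π v ∨ (cycleGraph 5).Adj (π u) (π v)) := by
    simp only [T3, fromEdgeSet_adj, Set.mem_insert_iff, Set.mem_singleton_iff]
    revert u v
    decide
  have card_fiber (i : Fin 5) : Nat.card {v // π v = i} = ![1, 2, 1, 2, 1] i := by
    rw [Nat.card_eq_fintype_card]
    revert i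
    decide
  refine (cls_eq_buoy_K (G := T3) adj_iff card_fiber).trans (cls_buoy_congr fun i => ?_)
  fin_cases i <;> rfl

lemma critFamily_one : critFamily 1 = {(K 1).cls} := by
  refine Set.eq_singleton_iff_unique_mem.2 ⟨cls_mem_critFamily_iff.2 ⟨?_, isP5HouseFree_top⟩, ?_⟩
  · refine ⟨fun {n} hn => ?_, fun {v} _ => ⟨0, rfl, ?_⟩⟩
    · by_contra! hn0
      obtain rfl : n = 0 := by omega
      exact (colorable_zero_iff.1 hn).false ⟨(0 : Fin 1), trivial⟩
    · exact colorable_zero_iff.2 ⟨fun u => u.2.2 (Subsingleton.elim (α := Fin 1) u.1 v)⟩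
  · rintro _ ⟨G, ⟨hcrit, -⟩, rfl⟩
    rw [isCritical_iff] at hcrit
    obtain ⟨v, -⟩ := hcrit.nonempty one_pos
    obtain ⟨n, hn, hcol⟩ := hcrit.exists_colorable_diff (Set.mem_univ v)
    obtain rfl : n = 0 := by omega
    have eq_v (u : G.V) : u = v := by
      by_contra hu
      exact (colorable_zero_iff.1 hcol).false ⟨u, trivial, hu⟩
    have : Unique G.V := ⟨⟨v⟩, eq_v⟩
    exact cls_eq_cls_K (fun u w huw => absurd ((eq_v u).trans (eq_v w).symm) huw) Nat.card_unique

end ConcreteGraphs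

section JoinFamily

variable {A B A' B' : Set IsoClass} {k l : ℕ}

/-- The join of isomorphism classes, which makes `joinSet` an instance of `Set.image2`. -/
def joinCls : IsoClass → IsoClass → IsoClass :=
  Quotient.map₂ join fun _ _ hG _ _ hH =>
    cls_eq_iff.1 (cls_join_congr (cls_eq_iff.2 hG) (cls_eq_iff.2 hH))

lemma joinCls_comm (c d : IsoClass) : joinCls c d = joinCls d c :=
  Quotient.inductionOn₂ c d cls_join_comm

lemma joinCls_assoc (c d e : IsoClass) : joinCls (joinCls c d) e = joinCls c (joinCls d e) :=
  Quotient.inductionOn₃ c d e cls_join_assoc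

lemma joinSet_eq_image2 (A B : Set IsoClass) : joinSet A B = Set.image2 joinCls A B := by
  ext c
  constructor
  · rintro ⟨G, H, hG, hH, rfl⟩
    exact ⟨_, hG, _, hH, rfl⟩
  · rintro ⟨⟨G⟩, hG, ⟨H⟩, hH, rfl⟩
    exact ⟨G, H, hG, hH, rfl⟩

lemma joinSet_mono (hA : A ⊆ A') (hB : B ⊆ B') : joinSet A B ⊆ joinSet A' B' := by
  simpa only [joinSet_eq_image2] using Set.image2_subset hA hB

lemma joinSet_comm (A B : Set IsoClass) : joinSet A B = joinSet B A := by
  simpa only [joinSet_eq_image2] using Set.image2_comm joinCls_comm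

lemma joinSet_assoc (A B C : Set IsoClass) :
    joinSet (joinSet A B) C = joinSet A (joinSet B C) := by
  simpa only [joinSet_eq_image2] using Set.image2_assoc joinCls_assoc

lemma joinSet_union_left (A B C : Set IsoClass) :
    joinSet (A ∪ B) C = joinSet A C ∪ joinSet B C := by
  simpa only [joinSet_eq_image2] using Set.image2_union_left

lemma joinSet_critFamily_subset (hk : 0 < k) (hl : 0 < l) :
    joinSet (critFamily k) (critFamily l) ⊆ critFamily (k + l) := by
  rintro _ ⟨G, H, hG, hH, rfl⟩
  exact cls_join_mem_critFamily hk hl hG hH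

lemma joinSet_critFamily_subset_joinFamily (hk : 0 < k) (hl : 0 < l) :
    joinSet (critFamily k) (critFamily l) ⊆ joinFamily (k + l) :=
  fun _ hc => ⟨k, l, hk, hl, rfl, hc⟩

lemma joinFamily_subset (h : ∀ a b, 0 < a → a ≤ b → a + b = k →
    joinSet (critFamily a) (critFamily b) ⊆ A) : joinFamily k ⊆ A := by
  rintro c ⟨a, b, ha, hb, hab, hc⟩
  rcases le_total a b with hle | hle
  · exact h a b ha hle hab hc
  · exact h b a hb hle ((add_comm b a).trans hab) (joinSet_comm _ _ ▸ hc)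

lemma joinSet_joinSet_one_subset (hk : 0 < k) (hl : 0 < l) :
    joinSet (joinSet (critFamily 1) (critFamily k)) (critFamily l) ⊆
      joinSet (critFamily 1) (critFamily (k + l)) :=
  (joinSet_assoc _ _ _).trans_subset (joinSet_mono subset_rfl (joinSet_critFamily_subset hk hl))

lemma joinFamily_two : joinFamily 2 = joinSet (critFamily 1) (critFamily 1) := by
  refine Set.Subset.antisymm (joinFamily_subset fun a b ha hle hab => ?_)
    (joinSet_critFamily_subset_joinFamily one_pos one_pos)
  obtain ⟨rfl, rfl⟩ : a = 1 ∧ b = 1 := by omega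
  exact subset_rfl

lemma critFamily_two_eq_joinSet : critFamily 2 = joinSet (critFamily 1) (critFamily 1) := by
  rw [critFamily_eq le_rfl, buoyFamily_eq_empty le_rfl, Set.union_empty, joinFamily_two]

lemma critFamily_two : critFamily 2 = {(K 2).cls} := by
  rw [critFamily_two_eq_joinSet, critFamily_one, joinSet_eq_image2, Set.image2_singleton]
  exact congrArg _ (cls_join_K 1 1)

lemma joinFamily_succ (hk : 2 ≤ k) (hk' : k ≤ 4) :
    joinFamily (k + 1) = joinSet (critFamily 1) (critFamily k) := by
  refine Set.Subset.antisymm (joinFamily_subset fun a b ha hle hab => ?_) ?_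
  · obtain rfl | rfl : a = 1 ∨ a = 2 := by omega
    · obtain rfl : b = k := by omega
      exact subset_rfl
    · obtain rfl : k = 1 + b := by omega
      rw [critFamily_two_eq_joinSet]
      exact joinSet_joinSet_one_subset one_pos (by omega)
  · rw [add_comm]
    exact joinSet_critFamily_subset_joinFamily one_pos (by omega)

lemma critFamily_three_eq_union :
    critFamily 3 = joinSet (critFamily 1) (critFamily 2) ∪ buoyFamily 3 := by
  rw [critFamily_eq (by norm_num), joinFamily_succ le_rfl (by norm_num)]

lemma joinSet_critFamily_three (A : Set IsoClass) : joinSet (critFamily 3) A =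
    joinSet (joinSet (critFamily 1) (critFamily 2)) A ∪ joinSet (buoyFamily 3) A := by
  rw [critFamily_three_eq_union, joinSet_union_left]

lemma joinFamily_six : joinFamily 6 =
    joinSet (critFamily 1) (critFamily 5) ∪ joinSet (buoyFamily 3) (buoyFamily 3) := by
  have buoyFamily_subset : buoyFamily 3 ⊆ critFamily 3 :=
    critFamily_three_eq_union ▸ Set.subset_union_right
  have join_two_subset :
      joinSet (joinSet (critFamily 1) (critFamily 2)) (critFamily 3) ⊆
        joinSet (critFamily 1) (critFamily 5) := joinSet_joinSet_one_subset two_pos three_pos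
  refine Set.Subset.antisymm (joinFamily_subset fun a b ha hle hab => ?_) (Set.union_subset ?_ ?_)
  · obtain ⟨rfl, rfl⟩ | ⟨rfl, rfl⟩ | ⟨rfl, rfl⟩ :
      (a = 1 ∧ b = 5) ∨ (a = 2 ∧ b = 4) ∨ (a = 3 ∧ b = 3) := by omega
    · exact Set.subset_union_left
    · rw [critFamily_two_eq_joinSet]
      exact (joinSet_joinSet_one_subset one_pos four_pos).trans Set.subset_union_left
    · rw [joinSet_critFamily_three]
      refine Set.union_subset (join_two_subset.trans Set.subset_union_left) ?_
      rw [joinSet_comm, joinSet_critFamily_three]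
      exact Set.union_subset_union_left _
        ((joinSet_mono subset_rfl buoyFamily_subset).trans join_two_subset)
  · exact joinSet_critFamily_subset_joinFamily one_pos (by norm_num)
  · exact (joinSet_mono buoyFamily_subset buoyFamily_subset).trans
      (joinSet_critFamily_subset_joinFamily three_pos three_pos)

end JoinFamily

/-- Formal expressions for graphs built from cliques and `C5` by joins and buoys, with finite
lists of them serving as computable descriptions of sets of isomorphism classes. -/
inductive GraphTerm
  | clique (n : ℕ)
  | c5
  | join (s t : GraphTerm)
  | buoy (t : Fin 5 → GraphTerm)

namespace GraphTerm

/-- The graph denoted by an expression. -/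
def eval : GraphTerm → FinGraph
  | clique n => K n
  | c5 => C5
  | join s t => FinGraph.join s.eval t.eval
  | buoy t => FinGraph.buoy fun i => (t i).eval

/-- The degree multiset of the denoted graph, by a recursion that the kernel can evaluate. -/
def degrees : GraphTerm → Multiset ℕ
  | clique n => Multiset.replicate n (n - 1)
  | c5 => Multiset.replicate 5 2
  | join s t => s.degrees.map (· + t.degrees.card) + t.degrees.map (· + s.degrees.card)
  | buoy t => ∑ i, (t i).degrees.map
      (· + ((t (i + 1)).degrees.card + (t (i - 1)).degrees.card))

lemma degrees_eval : (t : GraphTerm) → t.eval.degrees = t.degrees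
  | clique n => degrees_K n
  | c5 => degrees_C5
  | join s t => by
    rw [eval, degrees_join, degrees_eval s, degrees_eval t, degrees]
  | buoy t => by
    simp only [eval, degrees_buoy, degrees_eval, degrees]

/-- The isomorphism class of the denoted graph. -/
def toCls (t : GraphTerm) : IsoClass := t.eval.cls

/-- The set of isomorphism classes of the graphs denoted by the members of a list. -/
def classes (L : List GraphTerm) : Set IsoClass := {c | ∃ t ∈ L, t.toCls = c}

variable {L : List GraphTerm} {p : Fin 5 → ℕ}

@[simp] lemma classes_nil : classes [] = ∅ := by
  simp [classes]

@[simp] lemma classes_cons (t : GraphTerm) (L : List GraphTerm) :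
    classes (t :: L) = insert t.toCls (classes L) := by
  ext c
  simp [classes, eq_comm]

lemma classes_append (L M : List GraphTerm) : classes (L ++ M) = classes L ∪ classes M := by
  ext c
  simp [classes, or_and_right, exists_or]

lemma encard_classes (h : (L.map degrees).Nodup) : (classes L).encard = L.length := by
  induction L with
  | nil => simp
  | cons t L ih =>
    rw [List.map_cons, List.nodup_cons] at h
    have not_mem : t.toCls ∉ classes L := by
      rintro ⟨s, hs, hst⟩
      have := degrees_eq_of_cls_eq hst
      rw [degrees_eval, degrees_eval] at this
      exact h.1 (this ▸ List.mem_map_of_mem hs)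
    rw [classes_cons, Set.encard_insert_of_notMem not_mem, ih h.2, List.length_cons]
    norm_cast

lemma joinSet_classes (L M : List GraphTerm) :
    joinSet (classes L) (classes M) = classes (L.flatMap fun s => M.map (join s)) := by
  ext c
  simp only [joinSet_eq_image2, classes, Set.mem_image2, Set.mem_ofPred_eq, List.mem_flatMap,
    List.mem_map]
  constructor
  · rintro ⟨_, ⟨s, hs, rfl⟩, _, ⟨t, ht, rfl⟩, rfl⟩
    exact ⟨_, ⟨s, hs, t, ht, rfl⟩, rfl⟩
  · rintro ⟨_, ⟨s, hs, t, ht, rfl⟩, rfl⟩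
    exact ⟨_, ⟨s, hs, rfl⟩, _, ⟨t, ht, rfl⟩, rfl⟩

/-- All buoy expressions whose `i`-th bag is taken from the `i`-th list. -/
def buoys (L : Fin 5 → List GraphTerm) : List GraphTerm :=
  (L 0).flatMap fun a => (L 1).flatMap fun b => (L 2).flatMap fun c => (L 3).flatMap fun d =>
    (L 4).map fun e => buoy ![a, b, c, d, e]

lemma mem_buoys {L : Fin 5 → List GraphTerm} {t : GraphTerm} :
    t ∈ buoys L ↔ ∃ s, (∀ i, s i ∈ L i) ∧ buoy s = t := by
  simp only [buoys, List.mem_flatMap, List.mem_map]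
  constructor
  · rintro ⟨a, ha, b, hb, c, hc, d, hd, e, he, rfl⟩
    exact ⟨_, by simp [Fin.forall_fin_succ, *], rfl⟩
  · rintro ⟨s, hs, rfl⟩
    exact ⟨s 0, hs 0, s 1, hs 1, s 2, hs 2, s 3, hs 3, s 4, hs 4,
      congrArg buoy (List.ofFn_injective rfl)⟩

lemma buoysOfPattern_eq_classes {L : Fin 5 → List GraphTerm}
    (h : ∀ i, critFamily (p i) = classes (L i)) : buoysOfPattern p = classes (buoys L) := by
  ext c
  simp only [buoysOfPattern, h, classes, mem_buoys, Set.mem_ofPred_eq]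
  constructor
  · rintro ⟨B, hB, rfl⟩
    choose s hs hsB using hB
    exact ⟨_, ⟨s, hs, rfl⟩, cls_buoy_congr hsB⟩
  · rintro ⟨_, ⟨s, hs, rfl⟩, rfl⟩
    exact ⟨_, fun i => ⟨s i, hs i, rfl⟩, rfl⟩

lemma toCls_buoy_reverse (a b s t : GraphTerm) :
    (buoy ![a, s, b, t, a]).toCls = (buoy ![a, t, b, s, a]).toCls := by
  let reflection : cycleGraph 5 ≃g cycleGraph 5 :=
    ⟨Equiv.subLeft 4, fun {i j} => by revert i j; decide⟩
  refine (cls_buoy_comp_iso _ reflection).symm.trans (cls_buoy_congr fun i => ?_)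
  fin_cases i <;> rfl

/-- The buoys with bags `a`, `s`, `b`, `t`, `a` for `s`, `t` in a list, up to exchanging `s`
and `t`. -/
def symmetricBuoys (a b : GraphTerm) : List GraphTerm → List GraphTerm
  | [] => []
  | s :: L => (s :: L).map (fun t => buoy ![a, s, b, t, a]) ++ symmetricBuoys a b L

lemma mem_classes_symmetricBuoys {a b : GraphTerm} {c : IsoClass} :
    c ∈ classes (symmetricBuoys a b L) ↔
      ∃ s ∈ L, ∃ t ∈ L, (buoy ![a, s, b, t, a]).toCls = c := by
  induction L with
  | nil => simp [symmetricBuoys]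
  | cons s L ih =>
    have exists_cons_iff : (∃ u ∈ L, ∃ t ∈ s :: L, (buoy ![a, u, b, t, a]).toCls = c) ↔
        (∃ t ∈ L, (buoy ![a, s, b, t, a]).toCls = c) ∨
          ∃ u ∈ L, ∃ t ∈ L, (buoy ![a, u, b, t, a]).toCls = c := by
      simp only [List.exists_mem_cons_iff, toCls_buoy_reverse a b _ s, and_or_left, exists_or]
    have mem_map_iff : c ∈ classes ((s :: L).map fun t => buoy ![a, s, b, t, a]) ↔
        ∃ t ∈ s :: L, (buoy ![a, s, b, t, a]).toCls = c := by
      simp only [classes, List.mem_map, exists_exists_and_eq_and, Set.mem_ofPred_eq]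
    rw [symmetricBuoys, classes_append, Set.mem_union, ih, mem_map_iff,
      List.exists_mem_cons_iff (fun u => ∃ t ∈ s :: L, _), exists_cons_iff,
      List.exists_mem_cons_iff]
    rw [or_assoc, or_assoc, or_self_left]

lemma classes_buoys_symmetric (a b : GraphTerm) (L : List GraphTerm) :
    classes (buoys ![[a], L, [b], L, [a]]) = classes (symmetricBuoys a b L) := by
  ext c
  rw [mem_classes_symmetricBuoys]
  simp [classes, buoys, and_assoc]

/-- Expressions for the members of `buoyFamily k`, for `3 ≤ k ≤ 5`. -/
def buoyTerms : ℕ → List GraphTerm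
  | 3 => [c5]
  | 4 => [buoy ![clique 1, clique 2, clique 1, clique 2, clique 1]]
  | 5 => [buoy ![clique 2, clique 2, clique 2, clique 2, clique 1],
      buoy ![clique 2, clique 1, clique 3, clique 1, clique 2],
      buoy ![clique 2, clique 1, c5, clique 1, clique 2],
      buoy ![clique 1, clique 3, clique 1, clique 3, clique 1],
      buoy ![clique 1, clique 3, clique 1, c5, clique 1],
      buoy ![clique 1, c5, clique 1, c5, clique 1]]
  | _ => []

/-- Expressions for the members of `critFamily k`, for `1 ≤ k ≤ 4`. -/
def critTerms : ℕ → List GraphTerm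
  | 1 => [clique 1]
  | 2 => [clique 2]
  | 3 => clique 3 :: buoyTerms 3
  | 4 => clique 4 :: join (clique 1) c5 :: buoyTerms 4
  | _ => []

/-- Expressions for the members of `critFamily 5`. -/
def critTermsFive : List GraphTerm := (critTerms 4).map (join (clique 1)) ++ buoyTerms 5

/-- Expressions for the members of `buoyFamily 6`. -/
def buoyTermsSix : List GraphTerm :=
  buoys (critTerms ∘ ![2, 2, 2, 2, 3]) ++ buoys (critTerms ∘ ![2, 3, 2, 3, 1]) ++
    symmetricBuoys (clique 2) (clique 1) (critTerms 3) ++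
    buoys (critTerms ∘ ![1, 4, 1, 3, 2]) ++ symmetricBuoys (clique 1) (clique 1) (critTerms 4)

lemma classes_singleton (t : GraphTerm) : classes [t] = {t.toCls} := by
  rw [classes_cons, classes_nil, insert_empty_eq]

lemma toCls_join_clique (m n : ℕ) :
    (join (clique m) (clique n)).toCls = (clique (m + n)).toCls :=
  cls_join_K m n

lemma toCls_buoy (a b c d e : GraphTerm) : (buoy ![a, b, c, d, e]).toCls =
    (FinGraph.buoy ![a.eval, b.eval, c.eval, d.eval, e.eval]).cls :=
  cls_buoy_congr fun i => by fin_cases i <;> rfl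

lemma toCls_T2 : (join (clique 1) c5).toCls = T2.cls := cls_T2.symm

lemma toCls_T3 :
    (buoy ![clique 1, clique 2, clique 1, clique 2, clique 1]).toCls = T3.cls :=
  (toCls_buoy ..).trans cls_T3.symm

lemma critFamily_one_eq_classes : critFamily 1 = classes (critTerms 1) :=
  critFamily_one.trans (classes_singleton (clique 1)).symm

lemma critFamily_two_eq_classes : critFamily 2 = classes (critTerms 2) :=
  critFamily_two.trans (classes_singleton (clique 2)).symm

lemma joinSet_critFamily_one (L : List GraphTerm) :
    joinSet (critFamily 1) (classes L) = classes (L.map (join (clique 1))) := by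
  rw [critFamily_one_eq_classes, joinSet_classes, critTerms, List.flatMap_singleton]

lemma buoyFamily_three_eq_classes : buoyFamily 3 = classes (buoyTerms 3) := by
  have critFamily_pattern (i : Fin 5) :
      critFamily (![1, 1, 1, 1, 1] i) = classes (critTerms 1) := by
    fin_cases i <;> exact critFamily_one_eq_classes
  have toCls_ones : c5.toCls = (buoy ![clique 1, clique 1, clique 1, clique 1, clique 1]).toCls :=
    cls_C5.trans (cls_buoy_congr fun i => by fin_cases i <;> rfl)
  rw [patternsAre_three.buoyFamily_eq_buoysOfPattern, buoysOfPattern_eq_classes critFamily_pattern,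
    buoyTerms, classes_singleton, toCls_ones]
  exact classes_singleton _

lemma critFamily_three_eq_classes : critFamily 3 = classes (critTerms 3) := by
  rw [critFamily_three_eq_union, critFamily_two_eq_classes, joinSet_critFamily_one,
    buoyFamily_three_eq_classes, ← classes_append]
  simp [critTerms, buoyTerms, toCls_join_clique]

lemma joinFamily_four_eq_classes :
    joinFamily 4 = classes [clique 4, join (clique 1) c5] := by
  rw [joinFamily_succ (by norm_num) (by norm_num), critFamily_three_eq_classes,
    joinSet_critFamily_one]
  simp [critTerms, buoyTerms, toCls_join_clique]

lemma buoyFamily_four_eq_classes : buoyFamily 4 = classes (buoyTerms 4) := by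
  have critFamily_pattern (i : Fin 5) :
      critFamily (![1, 2, 1, 2, 1] i) = classes ((critTerms ∘ ![1, 2, 1, 2, 1]) i) := by
    fin_cases i
    exacts [critFamily_one_eq_classes, critFamily_two_eq_classes, critFamily_one_eq_classes,
      critFamily_two_eq_classes, critFamily_one_eq_classes]
  rw [patternsAre_four.buoyFamily_eq_buoysOfPattern, buoysOfPattern_eq_classes critFamily_pattern]
  rfl

lemma critFamily_four_eq_classes : critFamily 4 = classes (critTerms 4) := by
  rw [critFamily_eq (by norm_num), joinFamily_four_eq_classes, buoyFamily_four_eq_classes,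
    ← classes_append]
  rfl

lemma critFamily_eq_classes {k : ℕ} (hk : 0 < k) (hk' : k ≤ 4) :
    critFamily k = classes (critTerms k) := by
  interval_cases k
  exacts [critFamily_one_eq_classes, critFamily_two_eq_classes, critFamily_three_eq_classes,
    critFamily_four_eq_classes]

lemma buoysOfPattern_eq_classes_critTerms (hp : ∀ i, 0 < p i ∧ p i ≤ 4) :
    buoysOfPattern p = classes (buoys (critTerms ∘ p)) :=
  buoysOfPattern_eq_classes fun i => critFamily_eq_classes (hp i).1 (hp i).2

lemma buoysOfPattern_symmetric {k l m : ℕ} {a b : GraphTerm}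
    (hk : critFamily k = classes [a]) (hl : critFamily l = classes L)
    (hm : critFamily m = classes [b]) :
    buoysOfPattern ![k, l, m, l, k] = classes (symmetricBuoys a b L) := by
  rw [← classes_buoys_symmetric]
  exact buoysOfPattern_eq_classes fun i => by fin_cases i <;> assumption

lemma buoysOfPattern_22221_eq_classes :
    buoysOfPattern ![2, 2, 2, 2, 1] =
      classes [buoy ![clique 2, clique 2, clique 2, clique 2, clique 1]] :=
  buoysOfPattern_eq_classes_critTerms (by decide)

lemma buoysOfPattern_21312_eq_classes :
    buoysOfPattern ![2, 1, 3, 1, 2] =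
      classes [buoy ![clique 2, clique 1, clique 3, clique 1, clique 2],
        buoy ![clique 2, clique 1, c5, clique 1, clique 2]] :=
  buoysOfPattern_eq_classes_critTerms (by decide)

lemma buoysOfPattern_13131_eq_classes :
    buoysOfPattern ![1, 3, 1, 3, 1] =
      classes [buoy ![clique 1, clique 3, clique 1, clique 3, clique 1],
        buoy ![clique 1, clique 3, clique 1, c5, clique 1],
        buoy ![clique 1, c5, clique 1, c5, clique 1]] :=
  buoysOfPattern_symmetric critFamily_one_eq_classes critFamily_three_eq_classes
    critFamily_one_eq_classes

lemma buoyFamily_five_eq_classes : buoyFamily 5 = classes (buoyTerms 5) := by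
  rw [buoyFamily_five_eq_union, buoysOfPattern_22221_eq_classes, buoysOfPattern_21312_eq_classes,
    buoysOfPattern_13131_eq_classes, ← classes_append, ← classes_append]
  rfl

lemma joinFamily_five_eq_classes :
    joinFamily 5 = classes ((critTerms 4).map (join (clique 1))) := by
  rw [joinFamily_succ (by norm_num) (by norm_num), critFamily_four_eq_classes,
    joinSet_critFamily_one]

lemma critFamily_five_eq_classes : critFamily 5 = classes critTermsFive := by
  rw [critFamily_eq (by norm_num), joinFamily_five_eq_classes, buoyFamily_five_eq_classes,
    ← classes_append, critTermsFive]

lemma buoysOfPattern_22223_eq_classes :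
    buoysOfPattern ![2, 2, 2, 2, 3] = classes (buoys (critTerms ∘ ![2, 2, 2, 2, 3])) :=
  buoysOfPattern_eq_classes_critTerms (by decide)

lemma buoysOfPattern_23231_eq_classes :
    buoysOfPattern ![2, 3, 2, 3, 1] = classes (buoys (critTerms ∘ ![2, 3, 2, 3, 1])) :=
  buoysOfPattern_eq_classes_critTerms (by decide)

lemma buoysOfPattern_23132_eq_classes : buoysOfPattern ![2, 3, 1, 3, 2] =
    classes (symmetricBuoys (clique 2) (clique 1) (critTerms 3)) :=
  buoysOfPattern_symmetric critFamily_two_eq_classes critFamily_three_eq_classes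
    critFamily_one_eq_classes

lemma buoysOfPattern_14132_eq_classes :
    buoysOfPattern ![1, 4, 1, 3, 2] = classes (buoys (critTerms ∘ ![1, 4, 1, 3, 2])) :=
  buoysOfPattern_eq_classes_critTerms (by decide)

lemma buoysOfPattern_14141_eq_classes : buoysOfPattern ![1, 4, 1, 4, 1] =
    classes (symmetricBuoys (clique 1) (clique 1) (critTerms 4)) :=
  buoysOfPattern_symmetric critFamily_one_eq_classes critFamily_four_eq_classes
    critFamily_one_eq_classes

lemma buoyFamily_six_eq_classes : buoyFamily 6 = classes buoyTermsSix := by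
  rw [buoyFamily_six_eq_union, buoysOfPattern_22223_eq_classes, buoysOfPattern_23231_eq_classes,
    buoysOfPattern_23132_eq_classes, buoysOfPattern_14132_eq_classes,
    buoysOfPattern_14141_eq_classes]
  simp only [buoyTermsSix, classes_append]

lemma joinFamily_six_eq_classes :
    joinFamily 6 = classes (critTermsFive.map (join (clique 1)) ++ [join c5 c5]) := by
  rw [joinFamily_six, critFamily_five_eq_classes, joinSet_critFamily_one,
    buoyFamily_three_eq_classes, joinSet_classes, classes_append]
  rfl

lemma critFamily_six_eq_classes : critFamily 6 =
    classes (critTermsFive.map (join (clique 1)) ++ [join c5 c5] ++ buoyTermsSix) := by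
  rw [critFamily_eq (by norm_num), joinFamily_six_eq_classes, buoyFamily_six_eq_classes,
    ← classes_append]

end GraphTerm

section Classification

open GraphTerm

lemma critFamily_three : critFamily 3 = {(K 3).cls, C5.cls} := by
  rw [critFamily_three_eq_classes, critTerms, buoyTerms, classes_cons, classes_singleton]
  rfl

lemma buoyFamily_three : buoyFamily 3 = {C5.cls} :=
  buoyFamily_three_eq_classes.trans (classes_singleton c5)

lemma buoyFamily_four : buoyFamily 4 = {T3.cls} := by
  rw [buoyFamily_four_eq_classes, buoyTerms, classes_singleton, toCls_T3]

lemma joinFamily_four : joinFamily 4 = {T1.cls, T2.cls} := by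
  rw [joinFamily_four_eq_classes, classes_cons, classes_singleton, toCls_T2]
  rfl

lemma critFamily_four : critFamily 4 = {T1.cls, T2.cls, T3.cls} := by
  rw [critFamily_eq (by norm_num), joinFamily_four, buoyFamily_four, Set.insert_union,
    Set.singleton_union]

lemma buoysOfPattern_22221 : buoysOfPattern ![2, 2, 2, 2, 1] = {F4.cls} := by
  rw [buoysOfPattern_22221_eq_classes, classes_singleton, toCls_buoy]
  rfl

lemma buoysOfPattern_21312 : buoysOfPattern ![2, 1, 3, 1, 2] = {F5.cls, F6.cls} := by
  rw [buoysOfPattern_21312_eq_classes, classes_cons, classes_singleton, toCls_buoy, toCls_buoy]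
  rfl

lemma buoysOfPattern_13131 :
    buoysOfPattern ![1, 3, 1, 3, 1] = {F7.cls, F8.cls, F9.cls} := by
  rw [buoysOfPattern_13131_eq_classes, classes_cons, classes_cons, classes_singleton, toCls_buoy,
    toCls_buoy, toCls_buoy]
  rfl

lemma joinFamily_five : joinFamily 5 = {F1.cls, F2.cls, F3.cls} := by
  rw [joinFamily_succ (by norm_num) (by norm_num), critFamily_one, critFamily_four,
    joinSet_eq_image2, Set.image2_singleton_left, Set.image_insert_eq, Set.image_pair]
  rfl

lemma critFamily_five :
    critFamily 5 = {F1.cls, F2.cls, F3.cls, F4.cls, F5.cls, F6.cls, F7.cls, F8.cls, F9.cls} := by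
  rw [critFamily_eq (by norm_num), joinFamily_five, buoyFamily_five_eq_union,
    buoysOfPattern_22221, buoysOfPattern_21312, buoysOfPattern_13131]
  simp only [Set.insert_union, Set.singleton_union]

end Classification

section Cardinalities

open GraphTerm

lemma encard_critFamily_three : (critFamily 3).encard = 2 := by
  rw [critFamily_three_eq_classes, encard_classes (by decide +kernel)]
  rfl

lemma encard_critFamily_four : (critFamily 4).encard = 3 := by
  rw [critFamily_four_eq_classes, encard_classes (by decide +kernel)]
  rfl

lemma encard_critFamily_five : (critFamily 5).encard = 9 := by
  rw [critFamily_five_eq_classes, encard_classes (by decide +kernel)]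
  rfl

lemma encard_buoyFamily_five : (buoyFamily 5).encard = 6 := by
  rw [buoyFamily_five_eq_classes, encard_classes (by decide +kernel)]
  rfl

lemma encard_buoysOfPattern_22223 : (buoysOfPattern ![2, 2, 2, 2, 3]).encard = 2 := by
  rw [buoysOfPattern_22223_eq_classes, encard_classes (by decide +kernel)]
  rfl

lemma encard_buoysOfPattern_23231 : (buoysOfPattern ![2, 3, 2, 3, 1]).encard = 4 := by
  rw [buoysOfPattern_23231_eq_classes, encard_classes (by decide +kernel)]
  rfl

lemma encard_buoysOfPattern_23132 : (buoysOfPattern ![2, 3, 1, 3, 2]).encard = 3 := by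
  rw [buoysOfPattern_23132_eq_classes, encard_classes (by decide +kernel)]
  rfl

lemma encard_buoysOfPattern_14132 : (buoysOfPattern ![1, 4, 1, 3, 2]).encard = 6 := by
  rw [buoysOfPattern_14132_eq_classes, encard_classes (by decide +kernel)]
  rfl

lemma encard_buoysOfPattern_14141 : (buoysOfPattern ![1, 4, 1, 4, 1]).encard = 6 := by
  rw [buoysOfPattern_14141_eq_classes, encard_classes (by decide +kernel)]
  rfl

lemma encard_buoyFamily_six : (buoyFamily 6).encard = 21 := by
  rw [buoyFamily_six_eq_classes, encard_classes (by decide +kernel)]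
  rfl

lemma encard_joinFamily_six : (joinFamily 6).encard = 10 := by
  rw [joinFamily_six_eq_classes, encard_classes (by decide +kernel)]
  rfl

lemma encard_critFamily_six : (critFamily 6).encard = 31 := by
  rw [critFamily_six_eq_classes, encard_classes (by decide +kernel)]
  rfl

end Cardinalities

end FinGraph

theorem mainTheorem3 :
    -- `k = 1, 2, 3`
    (FinGraph.critFamily 1 = {(FinGraph.K 1).cls} ∧
      FinGraph.critFamily 2 = {(FinGraph.K 2).cls} ∧
      FinGraph.critFamily 3 = {(FinGraph.K 3).cls, FinGraph.C5.cls} ∧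
      (FinGraph.critFamily 3).encard = 2 ∧
      FinGraph.buoyFamily 1 = ∅ ∧ FinGraph.buoyFamily 2 = ∅ ∧
      FinGraph.buoyFamily 3 = {FinGraph.C5.cls}) ∧
    -- `k = 4`
    (FinGraph.critFamily 4 = FinGraph.joinFamily 4 ∪ FinGraph.buoyFamily 4 ∧
      FinGraph.PatternsAre 4 [![1, 2, 1, 2, 1]] ∧
      FinGraph.buoyFamily 4 = {FinGraph.T3.cls} ∧
      FinGraph.joinFamily 4 =
        FinGraph.joinSet (FinGraph.critFamily 1) (FinGraph.critFamily 3) ∧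
      FinGraph.joinFamily 4 = {FinGraph.T1.cls, FinGraph.T2.cls} ∧
      FinGraph.critFamily 4 = {FinGraph.T1.cls, FinGraph.T2.cls, FinGraph.T3.cls} ∧
      (FinGraph.critFamily 4).encard = 3) ∧
    -- `k = 5`
    (FinGraph.critFamily 5 = FinGraph.joinFamily 5 ∪ FinGraph.buoyFamily 5 ∧
      FinGraph.PatternsAre 5 [![2, 2, 2, 2, 1], ![2, 1, 3, 1, 2], ![1, 3, 1, 3, 1]] ∧
      FinGraph.buoysOfPattern ![2, 2, 2, 2, 1] = {FinGraph.F4.cls} ∧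
      FinGraph.buoysOfPattern ![2, 1, 3, 1, 2] = {FinGraph.F5.cls, FinGraph.F6.cls} ∧
      FinGraph.buoysOfPattern ![1, 3, 1, 3, 1] =
        {FinGraph.F7.cls, FinGraph.F8.cls, FinGraph.F9.cls} ∧
      (FinGraph.buoyFamily 5).encard = 6 ∧
      FinGraph.joinFamily 5 =
        FinGraph.joinSet (FinGraph.critFamily 1) (FinGraph.critFamily 4) ∧
      FinGraph.joinFamily 5 = {FinGraph.F1.cls, FinGraph.F2.cls, FinGraph.F3.cls} ∧
      FinGraph.critFamily 5 =
        {FinGraph.F1.cls, FinGraph.F2.cls, FinGraph.F3.cls, FinGraph.F4.cls, FinGraph.F5.cls,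
          FinGraph.F6.cls, FinGraph.F7.cls, FinGraph.F8.cls, FinGraph.F9.cls} ∧
      (FinGraph.critFamily 5).encard = 9) ∧
    -- `k = 6`
    (FinGraph.critFamily 6 = FinGraph.joinFamily 6 ∪ FinGraph.buoyFamily 6 ∧
      FinGraph.PatternsAre 6 [![2, 2, 2, 2, 3], ![2, 3, 2, 3, 1], ![2, 3, 1, 3, 2],
        ![1, 4, 1, 3, 2], ![1, 4, 1, 4, 1]] ∧
      FinGraph.buoyFamily 6 =
        FinGraph.buoysOfPattern ![2, 2, 2, 2, 3] ∪ FinGraph.buoysOfPattern ![2, 3, 2, 3, 1] ∪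
          FinGraph.buoysOfPattern ![2, 3, 1, 3, 2] ∪ FinGraph.buoysOfPattern ![1, 4, 1, 3, 2] ∪
          FinGraph.buoysOfPattern ![1, 4, 1, 4, 1] ∧
      (FinGraph.buoysOfPattern ![2, 2, 2, 2, 3]).encard = 2 ∧
      (FinGraph.buoysOfPattern ![2, 3, 2, 3, 1]).encard = 4 ∧
      (FinGraph.buoysOfPattern ![2, 3, 1, 3, 2]).encard = 3 ∧
      (FinGraph.buoysOfPattern ![1, 4, 1, 3, 2]).encard = 6 ∧
      (FinGraph.buoysOfPattern ![1, 4, 1, 4, 1]).encard = 6 ∧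
      (FinGraph.buoyFamily 6).encard = 21 ∧
      FinGraph.joinFamily 6 =
        FinGraph.joinSet (FinGraph.critFamily 1) (FinGraph.critFamily 5) ∪
          FinGraph.joinSet (FinGraph.buoyFamily 3) (FinGraph.buoyFamily 3) ∧
      (FinGraph.joinFamily 6).encard = 10 ∧
      (FinGraph.critFamily 6).encard = 31) :=
  open FinGraph in
  ⟨⟨critFamily_one, critFamily_two, critFamily_three, encard_critFamily_three,
      buoyFamily_eq_empty one_le_two, buoyFamily_eq_empty le_rfl, buoyFamily_three⟩,
    ⟨critFamily_eq (by norm_num), patternsAre_four, buoyFamily_four,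
      joinFamily_succ (by norm_num) (by norm_num), joinFamily_four, critFamily_four,
      encard_critFamily_four⟩,
    ⟨critFamily_eq (by norm_num), patternsAre_five, buoysOfPattern_22221, buoysOfPattern_21312,
      buoysOfPattern_13131, encard_buoyFamily_five, joinFamily_succ (by norm_num) (by norm_num),
      joinFamily_five, critFamily_five, encard_critFamily_five⟩,
    ⟨critFamily_eq (by norm_num), patternsAre_six, buoyFamily_six_eq_union,
      encard_buoysOfPattern_22223, encard_buoysOfPattern_23231, encard_buoysOfPattern_23132,
      encard_buoysOfPattern_14132, encard_buoysOfPattern_14141, encard_buoyFamily_six,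
      joinFamily_six, encard_joinFamily_six, encard_critFamily_six⟩⟩
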